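/- A parameterized problem over a finite alphabet $\Sigma$ is a set $L\subseteq\Sigma^*\times\mathbb{N}$. It belongs to the class W[P] if there are a computable function $f:\mathbb{N}\to\mathbb{N}$, a polynomial $p$ and a nondeterministic Turing machine that decides, for all $(x,k)\in\Sigma^*\times\mathbb{N}$, whether $(x,k)\in L$, such that every computation on $(x,k)$ has at most $f(k)\,p(|x|)$ steps, of which at most $f(k)\,\lfloor\log_2|x|\rfloor$ are nondeterministic (read $\lfloor\log_2|x|\rfloor$ as $0$ when $|x|=0$). Max Lin AA is the following parameterized problem. An instance consists of a system $Az=b$ of $m$ linear equations in $n$ variables over $\mathbb{F}_2$, in which every equation contains at least one variable (no row of $A$ is zero) and has a positive integral weight (written in binary), together with a parameter $k\in\mathbb{N}$. The excess of an assignment $z\in\mathbb{F}_2^n$ is the total weight of the equations satisfied by $z$ minus the total weight of the equations falsified by $z$. The question is whether the maximum excess over all assignments is at least $k$. Theorem. Max Lin AA is in the parameterized complexity class W[P]. -/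

import Mathlib

/-! ## Nondeterministic Turing machines with resource bounds -/

/-- A nondeterministic Turing machine with input alphabet `I`, given by two transition functions
`tr false` and `tr true`; in every step one of the two is applied.  The underlying deterministic
model is the multi-tape model `Turing.TM2` on which Mathlib's time-bounded computation
(`Turing.FinTM2`) is based: finitely many tapes used as stacks, a finite set of labels (control
states) and a finite internal memory. -/
structure NTM (I : Type) where
  /-- index set of the tapes -/
  K : Type
  [decK : DecidableEq K]
  [finK : Fintype K]
  /-- tape alphabets -/
  Γ : K → Type
  [finΓ : ∀ k, Fintype (Γ k)]
  /-- control states -/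
  Λ : Type
  [finΛ : Fintype Λ]
  /-- internal memory -/
  σ : Type
  [finσ : Fintype σ]
  /-- the tape holding the input -/
  inputTape : K
  /-- input letters are letters of the input tape -/
  letter : I ↪ Γ inputTape
  /-- initial control state -/
  main : Λ
  /-- initial internal memory -/
  init : σ
  /-- a halted computation is accepting if its internal memory satisfies `accept` -/
  accept : σ → Bool
  /-- the two transition functions -/
  tr : Bool → Λ → Turing.TM2.Stmt Γ Λ σ

namespace NTM

variable {I : Type}

attribute [instance] NTM.decK NTM.finK NTM.finΓ NTM.finΛ NTM.finσ

/-- Configurations: control state (`none` if halted), internal memory, tape contents. -/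
abbrev Cfg (M : NTM I) : Type := Turing.TM2.Cfg M.Γ M.Λ M.σ

/-- One step with the transition function `tr b`; the value is `none` iff `c` is halted. -/
def step (M : NTM I) (b : Bool) (c : M.Cfg) : Option M.Cfg := Turing.TM2.step (M.tr b) c

/-- The initial configuration on the input word `u`: the first letter of `u` is on top of the
input tape and all other tapes are empty. -/
def initCfg (M : NTM I) (u : List I) : M.Cfg where
  l := some M.main
  var := M.init
  stk := Function.update (fun _ => []) M.inputTape (u.map M.letter)

/-- `M.Run c t s d`: some partial computation of `M` leads from `c` to `d` in `t` steps, of which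
exactly `s` are nondeterministic, i.e. start in a configuration with two distinct successors. -/
inductive Run (M : NTM I) (c : M.Cfg) : ℕ → ℕ → M.Cfg → Prop
  | refl : Run M c 0 0 c
  | det {t s : ℕ} {d e : M.Cfg} (h : Run M c t s d)
      (h₀ : M.step false d = some e) (h₁ : M.step true d = some e) : Run M c (t + 1) s e
  | nondet {t s : ℕ} {d e : M.Cfg} (b : Bool) (h : Run M c t s d)
      (hne : M.step false d ≠ M.step true d) (hb : M.step b d = some e) :
      Run M c (t + 1) (s + 1) e

/-- `M` accepts `u` if some computation on `u` halts in an accepting configuration. -/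
def Accepts (M : NTM I) (u : List I) : Prop :=
  ∃ (t s : ℕ) (d : M.Cfg), M.Run (M.initCfg u) t s d ∧ d.l = none ∧ M.accept d.var = true

/-- Every computation of `M` on `u` makes at most `T` steps (so it halts), at most `S` of which are
nondeterministic. -/
def Bounded (M : NTM I) (u : List I) (T S : ℕ) : Prop :=
  ∀ (t s : ℕ) (d : M.Cfg), M.Run (M.initCfg u) t s d → t ≤ T ∧ s ≤ S

end NTM

/-! ## Parameterized problems and the class W[P] -/

/-- A parameterized problem over the alphabet `A` is a subset of `A* × ℕ`. -/
abbrev ParamProblem (A : Type) : Type := Set (List A × ℕ)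

/-- The input word that presents the instance `(x, k)` to a machine: the word `x` followed by `k`
copies of a new letter.  (Any other presentation of `k` defines the same class, as the time bound
may depend on `k` by an arbitrary computable factor.) -/
def paramInput {A : Type} (x : List A) (k : ℕ) : List (Option A) :=
  x.map some ++ List.replicate k none

/-- `L` is in W[P]: some nondeterministic Turing machine decides `(x, k) ∈ L` in at most
`f(k) · p(|x|)` steps, at most `f(k) · ⌊log₂ |x|⌋` of which are nondeterministic, for a computable
function `f` and a polynomial `p`. -/
def InWP {A : Type} (L : ParamProblem A) : Prop :=
  ∃ (M : NTM (Option A)) (f : ℕ → ℕ) (p : Polynomial ℕ), Computable f ∧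
    ∀ (x : List A) (k : ℕ),
      M.Bounded (paramInput x k) (f k * p.eval x.length) (f k * Nat.log 2 x.length) ∧
      (M.Accepts (paramInput x k) ↔ (x, k) ∈ L)

/-! ## Max Lin AA -/

/-- A weighted system `A z = b` of `m` linear equations in `n` variables over `𝔽₂`.  The weights are
positive integers and every equation contains at least one variable. -/
structure MaxLinSystem where
  n : ℕ
  m : ℕ
  A : Matrix (Fin m) (Fin n) (ZMod 2)
  b : Fin m → ZMod 2
  w : Fin m → ℕ
  w_pos : ∀ j, 0 < w j
  row_ne_zero : ∀ j, A j ≠ 0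

/-- The letters used to write down systems. -/
inductive SysLetter
  | zero
  | one
  | sep
  deriving DecidableEq

instance : Fintype SysLetter where
  elems := {.zero, .one, .sep}
  complete := by rintro (_ | _ | _) <;> simp

namespace MaxLinSystem

/-- The excess of an assignment: the total weight of satisfied equations minus the total weight of
falsified equations. -/
def excess (S : MaxLinSystem) (z : Fin S.n → ZMod 2) : ℤ :=
  (∑ j with S.A.mulVec z j = S.b j, (S.w j : ℤ)) - ∑ j with S.A.mulVec z j ≠ S.b j, (S.w j : ℤ)

/-- The maximum excess over all assignments. -/
def maxExcess (S : MaxLinSystem) : ℤ :=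
  Finset.univ.sup' Finset.univ_nonempty S.excess

/-- The letter for an element of `𝔽₂`. -/
def coeffLetter (a : ZMod 2) : SysLetter := if a = 0 then .zero else .one

/-- The letter for a binary digit. -/
def bitLetter (a : Bool) : SysLetter := if a then .one else .zero

/-- The equation number `j`: its `n` coefficients, its right-hand side, its weight in binary
(least significant digit first), and a separator. -/
def encodeEq (S : MaxLinSystem) (j : Fin S.m) : List SysLetter :=
  List.ofFn (fun i => coeffLetter (S.A j i)) ++
    coeffLetter (S.b j) :: ((Nat.bits (S.w j)).map bitLetter ++ [.sep])

/-- The word for a system: `n` in unary, a separator, and the equations one after the other. -/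
def encode (S : MaxLinSystem) : List SysLetter :=
  List.replicate S.n .one ++ .sep :: (List.ofFn S.encodeEq).flatten

end MaxLinSystem

/-- Max Lin AA parameterized by `k`: given a system, is its maximum excess at least `k`? -/
def MaxLinAA : ParamProblem SysLetter :=
  {q | ∃ S : MaxLinSystem, q.1 = S.encode ∧ (q.2 : ℤ) ≤ S.maxExcess}

/-!
Suppose some assignment has excess at least `k`, more than the average excess of all assignments.
Equations in the same class, that is, with the same left-hand side, are resolved together by the
assignment, so some class contributes positively, and it contains a satisfied equation. Eliminating
a variable by means of this equation keeps the excess of the assignment, turns the class into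
constants, and so raises the average by at least `1`. After `k` such eliminations the average, which
is `0` at first, is at least `k`. Conversely, some assignment reaches the average, and every
assignment for the system after an elimination stems from one with the same excess before it. So it
suffices to guess `k` equations. There are fewer of them than `2 ^ ⌊log₂ |x|⌋`, since an equation
takes up at least four letters, and so `⌊log₂ |x|⌋` bits name an equation.
-/

/-! ## Nondeterminism as an oracle -/

/-- `StepsTo f t a b`: iterating the partial function `f` from `a` is defined for `t` steps and
leads to `b`. -/
def StepsTo {α : Type*} (f : α → Option α) (t : ℕ) (a b : α) : Prop :=
  (fun x : Option α => x.bind f)^[t] (some a) = some b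

namespace StepsTo

variable {α : Type*} {f : α → Option α} {a b c : α} {t t' : ℕ}

theorem zero_iff : StepsTo f 0 a b ↔ a = b := by
  simp [StepsTo]

theorem succ_iff : StepsTo f (t + 1) a c ↔ ∃ b, StepsTo f t a b ∧ f b = some c := by
  simp only [StepsTo, Function.iterate_succ_apply']
  exact Option.bind_eq_some_iff

theorem single (h : f a = some b) : StepsTo f 1 a b := h

theorem trans (h : StepsTo f t a b) (h' : StepsTo f t' b c) : StepsTo f (t' + t) a c := by
  rw [StepsTo, Function.iterate_add_apply, h, h']

theorem cancel_left (h : StepsTo f t a b) (h' : StepsTo f (t' + t) a c) : StepsTo f t' b c := by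
  rwa [StepsTo, Function.iterate_add_apply, h] at h'

theorem eq_zero_of_halted (ha : f a = none) (h : StepsTo f t a b) : t = 0 := by
  cases t with
  | zero => rfl
  | succ t =>
    have hnone : (fun x : Option α => x.bind f)^[t] none = none := Function.iterate_fixed rfl t
    simp [StepsTo, ha, hnone] at h

theorem le_of_halted (h : StepsTo f t a b) (hb : f b = none) (h' : StepsTo f t' a c) :
    t' ≤ t := by
  by_contra! hlt
  obtain ⟨r, rfl⟩ := Nat.exists_eq_add_of_lt hlt
  rw [show t + r + 1 = r + 1 + t by omega] at h'
  exact absurd (eq_zero_of_halted hb (h.cancel_left h')) (Nat.succ_ne_zero r)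

theorem eq_of_halted (h : StepsTo f t a b) (hb : f b = none) (h' : StepsTo f t' a c)
    (hc : f c = none) : b = c := by
  obtain rfl := (h'.le_of_halted hc h).antisymm (h.le_of_halted hb h')
  exact Option.some.inj (h.symm.trans h')

end StepsTo

open Classical in
/-- One step of a computation whose guesses are read from the oracle `o`. A configuration is paired
with the number of guesses made so far; a guess is consumed only in a configuration with two
distinct successors. -/
noncomputable def guessStep {C : Type*} (step : Bool → C → Option C) (o : ℕ → Bool) (p : C × ℕ) :
    Option (C × ℕ) :=
  if step false p.1 = step true p.1 then (step false p.1).map (·, p.2)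
  else (step (o p.2) p.1).map (·, p.2 + 1)

theorem guessStep_of_eq {C : Type*} {step : Bool → C → Option C} {o : ℕ → Bool} {c d : C} {i : ℕ}
    (h : ∀ b, step b c = some d) : guessStep step o (c, i) = some (d, i) := by
  simp [guessStep, h]

theorem guessStep_of_ne {C : Type*} {step : Bool → C → Option C} {o : ℕ → Bool} {c : C} {i : ℕ}
    {d : Bool → C} (hd : d false ≠ d true) (h : ∀ b, step b c = some (d b)) :
    guessStep step o (c, i) = some (d (o i), i + 1) := by
  simp [guessStep, h, hd]

theorem StepsTo.guesses_le {C : Type*} {step : Bool → C → Option C} {o : ℕ → Bool} {p q : C × ℕ}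
    {t : ℕ} (h : StepsTo (guessStep step o) t p q) : p.2 ≤ q.2 := by
  induction t generalizing q with
  | zero => rw [StepsTo.zero_iff.1 h]
  | succ t ih =>
    obtain ⟨r, hr, hstep⟩ := StepsTo.succ_iff.1 h
    have hrq : r.2 ≤ q.2 := by
      unfold guessStep at hstep
      split_ifs at hstep <;> obtain ⟨d, _, rfl⟩ := Option.map_eq_some_iff.1 hstep <;> simp
    exact (ih hr).trans hrq

theorem guessStep_eq_none {C : Type*} {step : Bool → C → Option C} {o : ℕ → Bool} {c : C} {i : ℕ}
    (h : ∀ b, step b c = none) : guessStep step o (c, i) = none := by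
  simp [guessStep, h]

namespace NTM

variable {I : Type} {M : NTM I}

theorem step_eq_none {c : M.Cfg} (h : c.l = none) (b : Bool) : M.step b c = none := by
  obtain ⟨l, v, S⟩ := c
  subst h
  rfl

theorem Run.exists_oracle {c d : M.Cfg} {t s : ℕ} (h : M.Run c t s d) :
    ∃ o : ℕ → Bool, ∀ o' : ℕ → Bool, (∀ i < s, o' i = o i) →
      StepsTo (guessStep M.step o') t (c, 0) (d, s) := by
  induction h with
  | refl => exact ⟨fun _ => false, fun _ _ => StepsTo.zero_iff.2 rfl⟩
  | det _ h₀ h₁ ih =>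
    obtain ⟨o, ho⟩ := ih
    exact ⟨o, fun o' h => StepsTo.succ_iff.2
      ⟨_, ho o' h, guessStep_of_eq (Bool.forall_bool.2 ⟨h₀, h₁⟩)⟩⟩
  | @nondet t s d e b _ hne hb ih =>
    obtain ⟨o, ho⟩ := ih
    refine ⟨Function.update o s b, fun o' h => StepsTo.succ_iff.2 ⟨(d, s), ?_, ?_⟩⟩
    · exact ho o' fun i hi => by rw [h i (by omega), Function.update_of_ne hi.ne]
    · simp [guessStep, hne, h s (by omega), hb]

theorem Run.of_stepsTo {o : ℕ → Bool} {c d : M.Cfg} {t s : ℕ}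
    (h : StepsTo (guessStep M.step o) t (c, 0) (d, s)) : M.Run c t s d := by
  induction t generalizing d s with
  | zero =>
    cases StepsTo.zero_iff.1 h
    exact .refl
  | succ t ih =>
    obtain ⟨⟨e, r⟩, he, hstep⟩ := StepsTo.succ_iff.1 h
    by_cases heq : M.step false e = M.step true e
    · obtain ⟨h₀, rfl⟩ : M.step false e = some d ∧ r = s := by
        simpa [guessStep, heq] using hstep
      exact .det (ih he) h₀ (heq ▸ h₀)
    · obtain ⟨hb, rfl⟩ : M.step (o r) e = some d ∧ r + 1 = s := by
        simpa [guessStep, heq] using hstep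
      exact .nondet (o r) (ih he) heq hb

/-- If every oracle leads to a halted configuration, these computations are all there are. -/
theorem bounded_and_accepts_iff {u : List I} {T N : ℕ} (fin : (ℕ → Bool) → M.Cfg × ℕ)
    (halted : ∀ o, (fin o).1.l = none) (guesses_le : ∀ o, (fin o).2 ≤ N)
    (stepsTo : ∀ o, ∃ t ≤ T, StepsTo (guessStep M.step o) t (M.initCfg u, 0) (fin o)) :
    M.Bounded u T N ∧ (M.Accepts u ↔ ∃ o, M.accept (fin o).1.var = true) := by
  have final {o} : guessStep M.step o (fin o) = none :=
    guessStep_eq_none (step_eq_none (halted o))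
  refine ⟨fun t s d hr => ?_, ?_, ?_⟩
  · obtain ⟨o, ho⟩ := hr.exists_oracle
    have hd := ho o fun _ _ => rfl
    obtain ⟨T', hT', hfin⟩ := stepsTo o
    have hle : t ≤ T' := hfin.le_of_halted final hd
    have hrest : StepsTo (guessStep M.step o) (T' - t) (d, s) (fin o) :=
      hd.cancel_left (by rwa [Nat.sub_add_cancel hle])
    exact ⟨hle.trans hT', hrest.guesses_le.trans (guesses_le o)⟩
  · rintro ⟨t, s, d, hr, hd, hacc⟩
    obtain ⟨o, ho⟩ := hr.exists_oracle
    obtain ⟨_, _, hfin⟩ := stepsTo o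
    have heq : fin o = (d, s) := hfin.eq_of_halted final (ho o fun _ _ => rfl)
      (guessStep_eq_none (step_eq_none hd))
    exact ⟨o, heq ▸ hacc⟩
  · rintro ⟨o, hacc⟩
    obtain ⟨t, _, hfin⟩ := stepsTo o
    exact ⟨t, (fin o).2, (fin o).1, Run.of_stepsTo hfin, halted o, hacc⟩

end NTM

/-! ## A structured programming language for stack machines -/

theorem eval_le_eval_of_le (P : Polynomial ℕ) {a b : ℕ} (h : a ≤ b) : P.eval a ≤ P.eval b := by
  simp only [Polynomial.eval_eq_sum_range]
  gcongr

theorem eval_mul_le_pow_mul_eval (P : Polynomial ℕ) {a : ℕ} (ha : 0 < a) (b : ℕ) :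
    P.eval (a * b) ≤ a ^ P.natDegree * P.eval b := by
  simp only [Polynomial.eval_eq_sum_range, Finset.mul_sum, mul_pow]
  refine Finset.sum_le_sum fun i hi => ?_
  have hpow : a ^ i ≤ a ^ P.natDegree :=
    Nat.pow_le_pow_right ha (Finset.mem_range_succ_iff.1 hi)
  calc P.coeff i * (a ^ i * b ^ i) = a ^ i * (P.coeff i * b ^ i) := by ring
    _ ≤ a ^ P.natDegree * (P.coeff i * b ^ i) := by gcongr

/-- Programs over tapes `K` with letters `Γ` and internal memory `σ`, interpreted by `Prog.run`.
A popped letter, or `none` for an empty tape, and a guessed bit select the program to continue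
with, so they need not be stored in `σ`. -/
inductive Prog (K Γ σ : Type)
  | push (k : K) (f : σ → Γ)
  | pop (k : K) (p : Option Γ → Prog K Γ σ)
  | load (f : σ → σ)
  | flip (p : Bool → Prog K Γ σ)
  | seq (p q : Prog K Γ σ)
  | ite (c : σ → Bool) (p q : Prog K Γ σ)
  | forEach (k : K) (p : Γ → Prog K Γ σ)

namespace Prog

/-- What a program acts on: the internal memory, the tapes, and the number of guesses made. -/
structure State (K Γ σ : Type) where
  reg : σ
  tape : K → List Γ
  pos : ℕ

variable {K Γ σ : Type} [DecidableEq K]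

/-- The state with the tape `k` replaced by `x`. -/
def State.setTape (s : State K Γ σ) (k : K) (x : List Γ) : State K Γ σ :=
  { s with tape := Function.update s.tape k x }

@[simp] theorem State.tape_setTape_self (s : State K Γ σ) (k : K) (x : List Γ) :
    (s.setTape k x).tape k = x :=
  Function.update_self _ _ _

@[simp] theorem State.setTape_setTape_self (s : State K Γ σ) (k : K) (x y : List Γ) :
    (s.setTape k x).setTape k y = s.setTape k y := by
  simp [State.setTape]

theorem State.setTape_self {s : State K Γ σ} {k : K} {x : List Γ} (h : s.tape k = x) :
    s.setTape k x = s := by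
  simp [State.setTape, ← h]

theorem State.tape_setTape_of_ne {k k' : K} (h : k' ≠ k) (s : State K Γ σ) (x : List Γ) :
    (s.setTape k x).tape k' = s.tape k' :=
  Function.update_of_ne h _ _

theorem State.setTape_comm {k k' : K} (h : k ≠ k') (s : State K Γ σ) (x y : List Γ) :
    (s.setTape k x).setTape k' y = (s.setTape k' y).setTape k x := by
  simp only [State.setTape]
  rw [Function.update_comm h]

/-- The effect of a program whose guesses are read from the oracle `o`. The loop `forEach k p`
consumes the tape `k`, which its body sees as empty. -/
def run (o : ℕ → Bool) : Prog K Γ σ → State K Γ σ → State K Γ σ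
  | push k f, s => s.setTape k (f s.reg :: s.tape k)
  | pop k p, s => (p (s.tape k).head?).run o (s.setTape k (s.tape k).tail)
  | load f, s => { s with reg := f s.reg }
  | flip p, s => (p (o s.pos)).run o { s with pos := s.pos + 1 }
  | seq p q, s => q.run o (p.run o s)
  | ite c p q, s => bif c s.reg then p.run o s else q.run o s
  | forEach k p, s => (s.tape k).foldl (fun s a => (p a).run o s) (s.setTape k [])

section StaticChecks

variable [Fintype Γ]

/-- The program does not use the tape `k`. -/
def avoids (k : K) : Prog K Γ σ → Bool
  | push k' _ => k' ≠ k
  | pop k' p => k' ≠ k ∧ ∀ a, (p a).avoids k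
  | load _ => true
  | flip p => ∀ b, (p b).avoids k
  | seq p q => p.avoids k ∧ q.avoids k
  | ite _ p q => p.avoids k ∧ q.avoids k
  | forEach k' p => k' ≠ k ∧ ∀ a, (p a).avoids k

/-- How many letters a steady program (see `Prog.steady`) adds to the tapes at most. -/
def growth : Prog K Γ σ → ℕ
  | push _ _ => 1
  | pop _ p => max (p none).growth (Finset.univ.sup fun a => (p (some a)).growth - 1)
  | load _ => 0
  | flip p => max (p false).growth (p true).growth
  | seq p q => p.growth + q.growth
  | ite _ p q => max p.growth q.growth
  | forEach _ _ => 0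

/-- The loops of the program do not increase the total length of the tapes, because every iteration
adds at most one letter in exchange for the one it consumes. -/
def steady : Prog K Γ σ → Bool
  | push _ _ => true
  | pop _ p => ∀ a, (p a).steady
  | load _ => true
  | flip p => ∀ b, (p b).steady
  | seq p q => p.steady ∧ q.steady
  | ite _ p q => p.steady ∧ q.steady
  | forEach _ p => ∀ a, (p a).steady ∧ (p a).growth ≤ 1

/-- A syntactic condition under which a program can be run in polynomial time. -/
def wellFormed : Prog K Γ σ → Bool
  | push _ _ => true
  | pop _ p => ∀ a, (p a).wellFormed
  | load _ => true
  | flip p => ∀ b, (p b).wellFormed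
  | seq p q => p.wellFormed ∧ q.wellFormed
  | ite _ p q => p.wellFormed ∧ q.wellFormed
  | forEach k p => ∀ a, (p a).wellFormed ∧ (p a).avoids k ∧ (p a).steady

end StaticChecks

theorem run_setTape [Fintype Γ] {p : Prog K Γ σ} {k : K} (hp : p.avoids k) (o : ℕ → Bool)
    (s : State K Γ σ) (x : List Γ) :
    p.run o (s.setTape k x) = (p.run o s).setTape k x := by
  induction p generalizing s with
  | push k' f =>
    have hk : k' ≠ k := by simpa [avoids] using hp
    rw [run, run, State.tape_setTape_of_ne hk, State.setTape_comm hk]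
    rfl
  | pop k' p ih =>
    obtain ⟨hk, hp⟩ : k' ≠ k ∧ ∀ a, (p a).avoids k := by simpa [avoids] using hp
    rw [run, run, ← ih _ (hp _), State.tape_setTape_of_ne hk, State.setTape_comm hk]
  | load f => rfl
  | flip p ih =>
    have hp : ∀ b, (p b).avoids k := by simpa [avoids] using hp
    exact ih _ (hp _) { s with pos := s.pos + 1 }
  | seq p q ihp ihq =>
    obtain ⟨hp, hq⟩ : p.avoids k ∧ q.avoids k := by simpa [avoids] using hp
    rw [run, run, ihp hp, ihq hq]
  | ite c p q ihp ihq =>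
    obtain ⟨hp, hq⟩ : p.avoids k ∧ q.avoids k := by simpa [avoids] using hp
    simp only [run, ihp hp, ihq hq]
    cases h : c s.reg <;> simp [State.setTape, h]
  | forEach k' p ih =>
    obtain ⟨hk, hp⟩ : k' ≠ k ∧ ∀ a, (p a).avoids k := by simpa [avoids] using hp
    have hfold (l : List Γ) (s : State K Γ σ) :
        l.foldl (fun s a => (p a).run o s) (s.setTape k x) =
          (l.foldl (fun s a => (p a).run o s) s).setTape k x := by
      induction l generalizing s with
      | nil => rfl
      | cons a l ihl => rw [List.foldl_cons, ih a (hp a), ihl, List.foldl_cons]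
    rw [run, run, ← hfold, State.tape_setTape_of_ne hk, State.setTape_comm hk]

theorem tape_run_of_avoids [Fintype Γ] {p : Prog K Γ σ} {k : K} (hp : p.avoids k) (o : ℕ → Bool)
    (s : State K Γ σ) : (p.run o s).tape k = s.tape k := by
  have hrun := run_setTape hp o s (s.tape k)
  rw [State.setTape_self rfl] at hrun
  rw [hrun, State.tape_setTape_self]

section Size

variable [Fintype K]

/-- The total length of the tapes. -/
def State.size (s : State K Γ σ) : ℕ := ∑ k, (s.tape k).length

theorem State.size_setTape (s : State K Γ σ) (k : K) (x : List Γ) :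
    (s.setTape k x).size + (s.tape k).length = s.size + x.length := by
  simp only [State.size, State.setTape, Function.apply_update (fun _ => List.length),
    Finset.sum_update_of_mem (Finset.mem_univ k)]
  rw [← Finset.add_sum_erase _ _ (Finset.mem_univ k), Finset.sdiff_singleton_eq_erase]
  ring

theorem State.size_setTape_tail_le (s : State K Γ σ) (k : K) :
    (s.setTape k (s.tape k).tail).size ≤ s.size := by
  have := s.size_setTape k (s.tape k).tail
  simp only [List.length_tail] at this
  omega

omit [DecidableEq K] in
theorem State.length_tape_le_size (s : State K Γ σ) (k : K) : (s.tape k).length ≤ s.size :=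
  Finset.single_le_sum (f := fun k => (s.tape k).length) (fun _ _ => Nat.zero_le _)
    (Finset.mem_univ k)

theorem size_run_forEach_le {o : ℕ → Bool} {p : Γ → Prog K Γ σ} {c : ℕ}
    (h : ∀ a s, ((p a).run o s).size ≤ s.size + c) (k : K) (s : State K Γ σ) :
    ((forEach k p).run o s).size + (s.tape k).length ≤ s.size + c * (s.tape k).length := by
  have hfold (l : List Γ) (s : State K Γ σ) :
      (l.foldl (fun s a => (p a).run o s) s).size ≤ s.size + c * l.length := by
    induction l generalizing s with
    | nil => simp
    | cons a l ih =>
      have h₁ := ih ((p a).run o s)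
      have h₂ := h a s
      simp only [List.foldl_cons, List.length_cons, Nat.mul_succ]
      omega
  have h₁ := hfold (s.tape k) (s.setTape k [])
  have h₂ := s.size_setTape k []
  simp only [run, List.length_nil] at *
  omega

variable [Fintype Γ]

theorem size_run_le_of_steady {p : Prog K Γ σ} (hp : p.steady) (o : ℕ → Bool)
    (s : State K Γ σ) : (p.run o s).size ≤ s.size + p.growth := by
  induction p generalizing s with
  | push k f =>
    have := s.size_setTape k (f s.reg :: s.tape k)
    simp only [run, growth, List.length_cons] at *
    omega
  | pop k p ih =>
    have hp : ∀ a, (p a).steady := by simpa [steady] using hp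
    have hset := s.size_setTape k (s.tape k).tail
    have hrun := ih (s.tape k).head? (hp _) (s.setTape k (s.tape k).tail)
    simp only [run, growth]
    cases htape : s.tape k with
    | nil => grind
    | cons a l =>
      have hsup := Finset.le_sup (f := fun a => (p (some a)).growth - 1) (Finset.mem_univ a)
      grind
  | load f => exact Nat.le_add_right _ _
  | flip p ih =>
    have hp : ∀ b, (p b).steady := by simpa [steady] using hp
    have := ih (o s.pos) (hp _) { s with pos := s.pos + 1 }
    have hsize : State.size { s with pos := s.pos + 1 } = s.size := rfl
    simp only [run, growth]
    cases o s.pos <;> grind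
  | seq p q ihp ihq =>
    obtain ⟨hp, hq⟩ : p.steady ∧ q.steady := by simpa [steady] using hp
    have h₁ := ihp hp s
    have h₂ := ihq hq (p.run o s)
    simp only [run, growth]
    omega
  | ite c p q ihp ihq =>
    obtain ⟨hp, hq⟩ : p.steady ∧ q.steady := by simpa [steady] using hp
    have h₁ := ihp hp s
    have h₂ := ihq hq s
    simp only [run, growth]
    cases c s.reg <;> grind
  | forEach k p ih =>
    have hp : ∀ a, (p a).steady ∧ (p a).growth ≤ 1 := by simpa [steady] using hp
    have := size_run_forEach_le (o := o) (c := 1)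
      (fun a s => (ih a (hp a).1 s).trans (by grind)) k s
    simp only [growth]
    omega

theorem exists_size_run_forEach_le {p : Γ → Prog K Γ σ} (hp : ∀ a, (p a).steady) (k : K) :
    ∃ c, ∀ o s, ((forEach k p).run o s).size ≤ s.size * (c + 1) := by
  refine ⟨Finset.univ.sup fun a => (p a).growth, fun o s => ?_⟩
  have hbody (a : Γ) (s : State K Γ σ) := (size_run_le_of_steady (hp a) o s).trans
    (Nat.add_le_add_left (Finset.le_sup (f := fun a => (p a).growth) (Finset.mem_univ a)) _)
  have hrun := size_run_forEach_le hbody k s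
  have hlen := Nat.mul_le_mul_left (Finset.univ.sup fun a => (p a).growth)
    (s.length_tape_le_size k)
  linarith [Nat.zero_le (s.tape k).length]

theorem exists_size_run_le {p : Prog K Γ σ} (hp : p.wellFormed) :
    ∃ P : Polynomial ℕ, ∀ o s, (p.run o s).size ≤ P.eval s.size := by
  induction p with
  | push k f =>
    refine ⟨.X + 1, fun o s => ?_⟩
    simpa [growth] using size_run_le_of_steady (p := push k f) rfl o s
  | pop k p ih =>
    have hp : ∀ a, (p a).wellFormed := by simpa [wellFormed] using hp
    choose P hP using fun a => ih a (hp a)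
    refine ⟨∑ a, P a, fun o s => ?_⟩
    rw [Polynomial.eval_finsetSum]
    exact ((hP _ o _).trans (eval_le_eval_of_le _ (s.size_setTape_tail_le k))).trans
      (Finset.single_le_sum (f := fun a => (P a).eval s.size) (fun _ _ => Nat.zero_le _)
        (Finset.mem_univ _))
  | load f => exact ⟨.X, fun _ s => by simp [run, State.size]⟩
  | flip p ih =>
    have hp : ∀ b, (p b).wellFormed := by simpa [wellFormed] using hp
    choose P hP using fun b => ih b (hp b)
    refine ⟨P false + P true, fun o s => ?_⟩
    have := hP (o s.pos) o { s with pos := s.pos + 1 }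
    rw [Polynomial.eval_add, run]
    cases h : o s.pos <;> simp only [h, State.size] at this ⊢ <;> omega
  | seq p q ihp ihq =>
    obtain ⟨hp, hq⟩ : p.wellFormed ∧ q.wellFormed := by simpa [wellFormed] using hp
    obtain ⟨P, hP⟩ := ihp hp
    obtain ⟨Q, hQ⟩ := ihq hq
    refine ⟨Q.comp P, fun o s => ?_⟩
    rw [Polynomial.eval_comp]
    exact (hQ o _).trans (eval_le_eval_of_le Q (hP o s))
  | ite c p q ihp ihq =>
    obtain ⟨hp, hq⟩ : p.wellFormed ∧ q.wellFormed := by simpa [wellFormed] using hp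
    obtain ⟨P, hP⟩ := ihp hp
    obtain ⟨Q, hQ⟩ := ihq hq
    refine ⟨P + Q, fun o s => ?_⟩
    have h₁ := hP o s
    have h₂ := hQ o s
    rw [Polynomial.eval_add, run]
    cases c s.reg <;> simp only [cond_true, cond_false] <;> omega
  | forEach k p _ =>
    have hp : ∀ a, (p a).wellFormed ∧ (p a).avoids k ∧ (p a).steady := by
      simpa [wellFormed] using hp
    obtain ⟨c, hc⟩ := exists_size_run_forEach_le (fun a => (hp a).2.2) k
    exact ⟨.X * (.C c + 1), by simpa using hc⟩

end Size

/-! ## Running programs on machines -/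

/-- The control states of a machine that runs the program. -/
def Label : Prog K Γ σ → Type
  | push _ _ => Unit
  | pop _ p => Option (Σ a, (p a).Label)
  | load _ => Unit
  | flip p => Option (Σ b, (p b).Label)
  | seq p q => p.Label ⊕ q.Label
  | ite _ p q => Option (p.Label ⊕ q.Label)
  | forEach _ p => Option (Σ a, (p a).Label)

/-- The control state in which the program starts. -/
def entry : (p : Prog K Γ σ) → p.Label
  | push _ _ => ()
  | pop _ _ => (none : Option _)
  | load _ => ()
  | flip _ => (none : Option _)
  | seq p _ => .inl p.entry
  | ite _ _ _ => (none : Option _)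
  | forEach _ _ => (none : Option _)

omit [DecidableEq K] in
theorem finite_label [Finite Γ] (p : Prog K Γ σ) : Finite p.Label := by
  induction p with
  | push | load => exact inferInstanceAs (Finite Unit)
  | pop _ p ih => exact inferInstanceAs (Finite (Option (Σ a, (p a).Label)))
  | flip p ih => exact inferInstanceAs (Finite (Option (Σ b, (p b).Label)))
  | seq p q ihp ihq => exact inferInstanceAs (Finite (p.Label ⊕ q.Label))
  | ite c p q ihp ihq => exact inferInstanceAs (Finite (Option (p.Label ⊕ q.Label)))
  | forEach _ p ih => exact inferInstanceAs (Finite (Option (Σ a, (p a).Label)))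

/-- Statements of a machine whose memory holds the letter popped last next to that of a program. -/
abbrev MachineStmt (K Γ σ Λ : Type) : Type := Turing.TM2.Stmt (fun _ : K => Γ) Λ (σ × Option Γ)

/-- Continue in the control state `x`, or halt if it is `none`. -/
def leave {Λ : Type} : Option Λ → MachineStmt K Γ σ Λ
  | none => .halt
  | some l => .goto fun _ => l

/-- The transition function `b` of a machine that runs the program and then continues in `exit`.
The map `emb` places the control states of the program among those of the machine. -/
def transition (b : Bool) : (p : Prog K Γ σ) → {Λ : Type} → (emb : p.Label → Λ) →
    (exit : Option Λ) → p.Label → MachineStmt K Γ σ Λ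
  | push k f, _, _, exit, _ => .push k (fun v => f v.1) (leave exit)
  | pop k p, _, emb, _, none =>
    .pop k (fun v a => (v.1, a)) (.goto fun v => emb (some ⟨v.2, (p v.2).entry⟩))
  | pop _ p, _, emb, exit, some ⟨a, l⟩ =>
    (p a).transition b (fun l => emb (some ⟨a, l⟩)) exit l
  | load f, _, _, exit, _ => .load (fun v => (f v.1, v.2)) (leave exit)
  | flip p, _, emb, _, none => .goto fun _ => emb (some ⟨b, (p b).entry⟩)
  | flip p, _, emb, exit, some ⟨a, l⟩ => (p a).transition b (fun l => emb (some ⟨a, l⟩)) exit l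
  | seq p q, _, emb, _, .inl l =>
    p.transition b (fun l => emb (.inl l)) (some (emb (.inr q.entry))) l
  | seq _ q, _, emb, exit, .inr l => q.transition b (fun l => emb (.inr l)) exit l
  | ite c p q, _, emb, _, none => .branch (fun v => c v.1)
    (.goto fun _ => emb (some (.inl p.entry))) (.goto fun _ => emb (some (.inr q.entry)))
  | ite _ p _, _, emb, exit, some (.inl l) =>
    p.transition b (fun l => emb (some (.inl l))) exit l
  | ite _ _ q, _, emb, exit, some (.inr l) =>
    q.transition b (fun l => emb (some (.inr l))) exit l
  | forEach k p, _, emb, exit, none =>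
    .pop k (fun v a => (v.1, a)) (.branch (fun v => v.2.isSome)
      (.goto fun v => v.2.elim (emb none) fun a => emb (some ⟨a, (p a).entry⟩)) (leave exit))
  | forEach _ p, _, emb, _, some ⟨a, l⟩ =>
    (p a).transition b (fun l => emb (some ⟨a, l⟩)) (some (emb none)) l

/-- The machine configuration with control state `l` and last popped letter `a` that represents
the state, with the number of guesses made. -/
def State.config {Λ : Type} (s : State K Γ σ) (l : Option Λ) (a : Option Γ) :
    Turing.TM2.Cfg (fun _ : K => Γ) Λ (σ × Option Γ) × ℕ :=
  (⟨l, (s.reg, a), s.tape⟩, s.pos)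

@[simp] theorem stepAux_leave {Λ : Type} (x : Option Λ) (v : σ × Option Γ) (S : K → List Γ) :
    Turing.TM2.stepAux (leave x) v S = ⟨x, v, S⟩ := by
  cases x <;> rfl

theorem stepsTo_one {Λ : Type} {tr : Bool → Λ → MachineStmt K Γ σ Λ} {l : Λ}
    {q : MachineStmt K Γ σ Λ} (hq : ∀ b, tr b l = q) (o : ℕ → Bool) (s : State K Γ σ)
    (a : Option Γ) :
    StepsTo (guessStep (fun b => Turing.TM2.step (tr b)) o) 1 (s.config (some l) a)
      (Turing.TM2.stepAux q (s.reg, a) s.tape, s.pos) :=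
  .single (guessStep_of_eq fun b => congrArg (fun q => some (Turing.TM2.stepAux q _ _)) (hq b))

theorem stepsTo_forEach_nil {k : K} {p : Γ → Prog K Γ σ} {Λ : Type}
    {tr : Bool → Λ → MachineStmt K Γ σ Λ} {emb : (forEach k p).Label → Λ} {exit : Option Λ}
    (htr : ∀ b l, tr b (emb l) = (forEach k p).transition b emb exit l) (o : ℕ → Bool)
    {s : State K Γ σ} (hk : s.tape k = []) (a : Option Γ) :
    StepsTo (guessStep (fun b => Turing.TM2.step (tr b)) o) 1
      (s.config (some (emb (forEach k p).entry)) a) (s.config exit none) := by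
  have hstep := stepsTo_one (htr · (none : Option _)) o s a
  have hself : Function.update s.tape k [] = s.tape := by rw [← hk, Function.update_eq_self]
  simp only [Turing.TM2.stepAux, hk, List.head?_nil, List.tail_nil, Option.isSome_none,
    cond_false, stepAux_leave, hself] at hstep
  exact hstep

theorem stepsTo_forEach_cons {k : K} {p : Γ → Prog K Γ σ} {Λ : Type}
    {tr : Bool → Λ → MachineStmt K Γ σ Λ} {emb : (forEach k p).Label → Λ} {exit : Option Λ}
    (htr : ∀ b l, tr b (emb l) = (forEach k p).transition b emb exit l) (o : ℕ → Bool)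
    (s : State K Γ σ) (x : Γ) (l : List Γ) (a : Option Γ) :
    StepsTo (guessStep (fun b => Turing.TM2.step (tr b)) o) 1
      ((s.setTape k (x :: l)).config (some (emb (forEach k p).entry)) a)
      ((s.setTape k l).config (some (emb (some ⟨x, (p x).entry⟩))) (some x)) := by
  have hstep := stepsTo_one (htr · (none : Option _)) o (s.setTape k (x :: l)) a
  simp only [Turing.TM2.stepAux, State.tape_setTape_self, List.head?_cons, List.tail_cons,
    Option.isSome_some, cond_true, Option.elim_some] at hstep
  rw [← State.setTape_setTape_self s k (x :: l) l]
  exact hstep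

section Time

variable [Fintype K]

/-- Wherever the control states of the program are placed in a machine, the machine runs the
program in at most `P n` steps when started in a state of size `n`. -/
def RunsIn (p : Prog K Γ σ) (P : Polynomial ℕ) : Prop :=
  ∀ {Λ : Type} (tr : Bool → Λ → MachineStmt K Γ σ Λ) (emb : p.Label → Λ) (exit : Option Λ),
    emb.Injective → (∀ b l, tr b (emb l) = p.transition b emb exit l) →
    ∀ (o : ℕ → Bool) (s : State K Γ σ) (a : Option Γ), ∃ t ≤ P.eval s.size, ∃ a',
      StepsTo (guessStep (fun b => Turing.TM2.step (tr b)) o) t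
        (s.config (some (emb p.entry)) a) ((p.run o s).config exit a')

theorem runsIn_push (k : K) (f : σ → Γ) : RunsIn (push k f) 1 := by
  intro Λ tr emb exit _ htr o s a
  have hstep := stepsTo_one (htr · ()) o s a
  rw [Turing.TM2.stepAux, stepAux_leave] at hstep
  exact ⟨1, by simp, a, hstep⟩

theorem runsIn_load (f : σ → σ) : RunsIn (load f : Prog K Γ σ) 1 := by
  intro Λ tr emb exit _ htr o s a
  have hstep := stepsTo_one (htr · ()) o s a
  rw [Turing.TM2.stepAux, stepAux_leave] at hstep
  exact ⟨1, by simp, a, hstep⟩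

theorem RunsIn.pop [Fintype Γ] {p : Option Γ → Prog K Γ σ} {P : Option Γ → Polynomial ℕ}
    (h : ∀ a, RunsIn (p a) (P a)) (k : K) : RunsIn (pop k p) (∑ a, P a + 1) := by
  intro Λ tr emb exit hemb htr o s a
  have hentry (b : Bool) : tr b (emb (Prog.pop k p).entry) = .pop k (fun v a => (v.1, a))
      (.goto fun v => emb (some ⟨v.2, (p v.2).entry⟩)) := htr b _
  obtain ⟨t, ht, a', hrest⟩ := h (s.tape k).head? tr (fun l => emb (some ⟨_, l⟩)) exit
    (hemb.comp ((Option.some_injective _).comp sigma_mk_injective)) (fun b l => htr b _) o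
    (s.setTape k (s.tape k).tail) (s.tape k).head?
  refine ⟨t + 1, ?_, a', (stepsTo_one hentry o s a).trans hrest⟩
  have hP := Finset.single_le_sum (f := fun a => (P a).eval s.size) (fun _ _ => Nat.zero_le _)
    (Finset.mem_univ (s.tape k).head?)
  have hmono := eval_le_eval_of_le (P (s.tape k).head?) (s.size_setTape_tail_le k)
  simp only [Polynomial.eval_add, Polynomial.eval_finsetSum, Polynomial.eval_one]
  omega

theorem RunsIn.flip {p : Bool → Prog K Γ σ} {P : Bool → Polynomial ℕ}
    (h : ∀ b, RunsIn (p b) (P b)) : RunsIn (flip p) (P false + P true + 1) := by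
  intro Λ tr emb exit hemb htr o s a
  let d (b : Bool) : Turing.TM2.Cfg (fun _ : K => Γ) Λ (σ × Option Γ) :=
    ⟨some (emb (some ⟨b, (p b).entry⟩)), (s.reg, a), s.tape⟩
  have hfirst : StepsTo (guessStep (fun b => Turing.TM2.step (tr b)) o) 1
      (s.config (some (emb (Prog.flip p).entry)) a) (d (o s.pos), s.pos + 1) :=
    .single (guessStep_of_ne (d := d) (fun h => by
        cases hemb (Option.some.inj (congrArg Turing.TM2.Cfg.l h)))
      fun b => congrArg (fun q => some (Turing.TM2.stepAux q _ _)) (htr b _))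
  obtain ⟨t, ht, a', hrest⟩ := h (o s.pos) tr (fun l => emb (some ⟨_, l⟩)) exit
    (hemb.comp ((Option.some_injective _).comp sigma_mk_injective)) (fun b l => htr b _) o
    { s with pos := s.pos + 1 } a
  refine ⟨t + 1, ?_, a', hfirst.trans hrest⟩
  have hsize : State.size { s with pos := s.pos + 1 } = s.size := rfl
  simp only [Polynomial.eval_add, Polynomial.eval_one]
  cases h : o s.pos <;> simp only [h, hsize] at ht <;> omega

theorem RunsIn.mono {p : Prog K Γ σ} {P Q : Polynomial ℕ} (h : RunsIn p P)
    (hle : ∀ n, P.eval n ≤ Q.eval n) : RunsIn p Q := by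
  intro Λ tr emb exit hemb htr o s a
  obtain ⟨t, ht, hrun⟩ := h tr emb exit hemb htr o s a
  exact ⟨t, ht.trans (hle _), hrun⟩

theorem RunsIn.seq {p q : Prog K Γ σ} {P Q S : Polynomial ℕ} (hp : RunsIn p P) (hq : RunsIn q Q)
    (hS : ∀ o s, (p.run o s).size ≤ S.eval s.size) : RunsIn (seq p q) (P + Q.comp S) := by
  intro Λ tr emb exit hemb htr o s a
  obtain ⟨t, ht, a', hfirst⟩ := hp tr (fun l => emb (.inl l)) (some (emb (.inr q.entry)))
    (hemb.comp Sum.inl_injective) (fun b l => htr b _) o s a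
  obtain ⟨t', ht', a'', hrest⟩ := hq tr (fun l => emb (.inr l)) exit
    (hemb.comp Sum.inr_injective) (fun b l => htr b _) o (p.run o s) a'
  refine ⟨t' + t, ?_, a'', hfirst.trans hrest⟩
  have := eval_le_eval_of_le Q (hS o s)
  simp only [Polynomial.eval_add, Polynomial.eval_comp]
  omega

theorem RunsIn.ite {p q : Prog K Γ σ} {P Q : Polynomial ℕ} (hp : RunsIn p P) (hq : RunsIn q Q)
    (c : σ → Bool) : RunsIn (ite c p q) (P + Q + 1) := by
  intro Λ tr emb exit hemb htr o s a
  have hfirst := stepsTo_one (htr · (Prog.ite c p q).entry) o s a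
  rw [Turing.TM2.stepAux] at hfirst
  simp only [Polynomial.eval_add, Polynomial.eval_one, run]
  cases hc : c s.reg <;> rw [hc] at hfirst
  · obtain ⟨t, ht, a', hrest⟩ := hq tr (fun l => emb (some (.inr l))) exit
      (hemb.comp ((Option.some_injective _).comp Sum.inr_injective)) (fun b l => htr b _) o s a
    exact ⟨t + 1, by omega, a', hfirst.trans hrest⟩
  · obtain ⟨t, ht, a', hrest⟩ := hp tr (fun l => emb (some (.inl l))) exit
      (hemb.comp ((Option.some_injective _).comp Sum.inl_injective)) (fun b l => htr b _) o s a
    exact ⟨t + 1, by omega, a', hfirst.trans hrest⟩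

theorem RunsIn.forEach [Fintype Γ] {k : K} {p : Γ → Prog K Γ σ} {P : Polynomial ℕ} {c : ℕ}
    (havoids : ∀ a, (p a).avoids k) (hsize : ∀ a o s, ((p a).run o s).size ≤ s.size + c)
    (h : ∀ a, RunsIn (p a) P) :
    RunsIn (forEach k p) ((.X + 1) * (P.comp (.X * (.C c + 1)) + 1)) := by
  intro Λ tr emb exit hemb htr o s a
  let head : Λ := emb (Prog.forEach k p).entry
  have hloop (N : ℕ) (l : List Γ) (s : State K Γ σ) (a : Option Γ)
      (hN : s.size + (c + 1) * l.length ≤ N) (hk : s.tape k = []) :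
      ∃ t ≤ (l.length + 1) * (P.eval N + 1), ∃ a',
        StepsTo (guessStep (fun b => Turing.TM2.step (tr b)) o) t
          ((s.setTape k l).config (some head) a)
          ((l.foldl (fun s a => (p a).run o s) s).config exit a') := by
    induction l generalizing s a with
    | nil =>
      rw [State.setTape_self hk]
      exact ⟨1, by simp, none, stepsTo_forEach_nil htr o hk a⟩
    | cons x l ih =>
      have hlen : (s.setTape k l).size = s.size + l.length := by
        simpa [hk] using s.size_setTape k l
      rw [List.length_cons] at hN ⊢
      have hP : P.eval (s.setTape k l).size ≤ P.eval N :=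
        eval_le_eval_of_le P (by rw [hlen]; nlinarith)
      obtain ⟨t, ht, a', hbody⟩ := h x tr (fun l => emb (some ⟨x, l⟩)) (some head)
        (hemb.comp ((Option.some_injective _).comp sigma_mk_injective)) (fun b l => htr b _) o
        (s.setTape k l) (some x)
      rw [run_setTape (havoids x)] at hbody
      obtain ⟨t', ht', a'', hrest⟩ := ih ((p x).run o s) a' (by linarith [hsize x o s])
        ((tape_run_of_avoids (havoids x) o s).trans hk)
      exact ⟨_, by linarith, a'', ((stepsTo_forEach_cons htr o s x l a).trans hbody).trans hrest⟩
  have hset := s.size_setTape k []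
  have hlen := s.length_tape_le_size k
  obtain ⟨t, ht, a', hrun⟩ := hloop (s.size * (c + 1)) (s.tape k) (s.setTape k []) a
    (by simp only [List.length_nil] at hset; nlinarith) (s.tape_setTape_self k [])
  rw [State.setTape_setTape_self, State.setTape_self rfl] at hrun
  refine ⟨t, ht.trans ?_, a', hrun⟩
  simp only [Polynomial.eval_mul, Polynomial.eval_add, Polynomial.eval_X, Polynomial.eval_one,
    Polynomial.eval_comp, Polynomial.eval_C]
  gcongr

theorem exists_runsIn [Fintype Γ] {p : Prog K Γ σ} (hp : p.wellFormed) :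
    ∃ P : Polynomial ℕ, RunsIn p P := by
  induction p with
  | push k f => exact ⟨1, runsIn_push k f⟩
  | pop k p ih =>
    have hp : ∀ a, (p a).wellFormed := by simpa [wellFormed] using hp
    choose P hP using fun a => ih a (hp a)
    exact ⟨_, RunsIn.pop hP k⟩
  | load f => exact ⟨1, runsIn_load f⟩
  | flip p ih =>
    have hp : ∀ b, (p b).wellFormed := by simpa [wellFormed] using hp
    choose P hP using fun b => ih b (hp b)
    exact ⟨_, RunsIn.flip hP⟩
  | seq p q ihp ihq =>
    obtain ⟨hp, hq⟩ : p.wellFormed ∧ q.wellFormed := by simpa [wellFormed] using hp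
    obtain ⟨P, hP⟩ := ihp hp
    obtain ⟨Q, hQ⟩ := ihq hq
    obtain ⟨S, hS⟩ := exists_size_run_le hp
    exact ⟨_, hP.seq hQ hS⟩
  | ite c p q ihp ihq =>
    obtain ⟨hp, hq⟩ : p.wellFormed ∧ q.wellFormed := by simpa [wellFormed] using hp
    obtain ⟨P, hP⟩ := ihp hp
    obtain ⟨Q, hQ⟩ := ihq hq
    exact ⟨_, hP.ite hQ c⟩
  | forEach k p ih =>
    have hp : ∀ a, (p a).wellFormed ∧ (p a).avoids k ∧ (p a).steady := by
      simpa [wellFormed] using hp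
    choose P hP using fun a => ih a (hp a).1
    have hgrowth (a : Γ) (o : ℕ → Bool) (s : State K Γ σ) :
        ((p a).run o s).size ≤ s.size + Finset.univ.sup fun a => (p a).growth :=
      (size_run_le_of_steady (hp a).2.2 o s).trans
        (Nat.add_le_add_left (Finset.le_sup (f := fun a => (p a).growth) (Finset.mem_univ a)) _)
    exact ⟨_, RunsIn.forEach (P := ∑ a, P a) (fun a => (hp a).2.1) hgrowth fun a =>
      RunsIn.mono (hP a) fun n => by
        rw [Polynomial.eval_finsetSum]
        exact Finset.single_le_sum (f := fun a => (P a).eval n) (fun _ _ => Nat.zero_le _)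
          (Finset.mem_univ a)⟩

end Time

variable {A : Type}

/-- The state with `word` on the tape `k` in which no guesses have been made. -/
def State.initial (r : σ) (k : K) (word : List Γ) : State K Γ σ :=
  State.setTape ⟨r, fun _ => [], 0⟩ k word

theorem State.size_initial [Fintype K] (r : σ) (k : K) (word : List Γ) :
    (State.initial r k word).size = word.length := by
  have hempty : State.size (⟨r, fun _ => [], 0⟩ : State K Γ σ) = 0 := by simp [State.size]
  simpa [hempty, State.initial] using State.size_setTape ⟨r, fun _ => [], 0⟩ k word

/-- The machine that runs the program on the input tape `k`. -/
noncomputable def machine [Fintype K] [Fintype Γ] [Fintype σ] (p : Prog K Γ σ) (k : K)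
    (letter : Option A ↪ Γ) (r : σ) (accept : σ → Bool) : NTM (Option A) :=
  have := p.finite_label
  have := Fintype.ofFinite p.Label
  { K := K
    Γ := fun _ => Γ
    Λ := p.Label
    σ := σ × Option Γ
    inputTape := k
    letter := letter
    main := p.entry
    init := (r, none)
    accept := fun v => accept v.1
    tr := fun b => p.transition b id none }

theorem inWP [Finite K] [Fintype Γ] [Finite σ] {p : Prog K Γ σ} (hp : p.wellFormed) (k₀ : K)
    (letter : Option A ↪ Γ) (r : σ) (accept : σ → Bool) {f : ℕ → ℕ} (hf : Computable f)
    {L : ParamProblem A}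
    (hpos : ∀ x k o, (p.run o (.initial r k₀ ((paramInput x k).map letter))).pos
      ≤ f k * Nat.log 2 x.length)
    (haccept : ∀ x k, (x, k) ∈ L ↔
      ∃ o, accept (p.run o (.initial r k₀ ((paramInput x k).map letter))).reg = true) :
    InWP L := by
  have := Fintype.ofFinite K
  have := Fintype.ofFinite σ
  obtain ⟨P, hP⟩ := exists_runsIn hp
  refine ⟨p.machine k₀ letter r accept, fun k => f k + (k + 1) ^ P.natDegree, P.comp (.X + 1),
    ?_, fun x k => ?_⟩
  · exact Primrec.nat_add.to_comp.comp hf ((Primrec₂.unpaired'.1 Nat.Primrec.pow).comp Primrec.succ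
      (Primrec.const _)).to_comp
  set s := State.initial r k₀ ((paramInput x k).map letter) with hs
  have hsize : s.size ≤ (k + 1) * (x.length + 1) := by
    simp only [hs, State.size_initial, paramInput, List.length_map, List.length_append,
      List.length_replicate]
    nlinarith
  have htime : P.eval s.size ≤
      (f k + (k + 1) ^ P.natDegree) * (P.comp (.X + 1)).eval x.length := by
    refine (eval_le_eval_of_le P hsize).trans ?_
    refine (eval_mul_le_pow_mul_eval P (Nat.add_one_pos k) _).trans ?_
    simp only [Polynomial.eval_comp, Polynomial.eval_add, Polynomial.eval_X, Polynomial.eval_one]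
    exact Nat.mul_le_mul_right _ (Nat.le_add_left _ _)
  choose t ht a hrun using fun o => hP (fun b => p.transition b id none) id none
    Function.injective_id (fun _ _ => rfl) o s none
  have hsound := NTM.bounded_and_accepts_iff (M := p.machine k₀ letter r accept)
    (u := paramInput x k) (N := (f k + (k + 1) ^ P.natDegree) * Nat.log 2 x.length)
    (fun o => (p.run o s).config none (a o)) (fun _ => rfl)
    (fun o => (hpos x k o).trans (Nat.mul_le_mul_right _ (Nat.le_add_right _ _)))
    (fun o => ⟨t o, (ht o).trans htime, hrun o⟩)
  exact ⟨hsound.1, hsound.2.trans (haccept x k).symm⟩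

end Prog

/-! ## Elimination in weighted systems of linear equations over `𝔽₂` -/

/-- A weighted linear equation over `𝔽₂`, given by its coefficients, its right-hand side and its
weight. -/
structure Equation where
  row : List Bool
  rhs : Bool
  wt : ℕ

theorem exists_sum_class_pos {α β : Type} [DecidableEq β] (g : α → β) (f : α → ℤ) (l : List α)
    (h : 0 < (l.map f).sum) :
    ∃ a ∈ l, 0 < f a ∧ 0 < (l.map fun x => if g x = g a then f x else 0).sum := by
  have hclasses : (l.map f).sum =
      ∑ b ∈ (l.map g).toFinset, (l.map fun x => if g x = b then f x else 0).sum := by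
    simp only [← Fin.sum_univ_fun_getElem]
    rw [Finset.sum_comm]
    refine Finset.sum_congr rfl fun i _ => ?_
    rw [Finset.sum_ite_eq, if_pos (List.mem_toFinset.2 (List.mem_map_of_mem (List.getElem_mem _)))]
  rw [hclasses] at h
  obtain ⟨b, -, hb⟩ := Finset.exists_lt_of_sum_lt (Finset.sum_const_zero.trans_lt h)
  obtain ⟨a, ha, hpos⟩ : ∃ a ∈ l, 0 < if g a = b then f a else 0 := by
    by_contra! hnonpos
    refine hb.not_ge ((List.sum_le_sum (g := fun _ => (0 : ℤ)) hnonpos).trans ?_)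
    simp
  obtain rfl : g a = b := by
    by_contra hne
    simp [hne] at hpos
  exact ⟨a, ha, by simpa using hpos, hb⟩

namespace Equation

/-- The value of a linear form. -/
def dot : List Bool → (ℕ → Bool) → Bool
  | [], _ => false
  | a :: r, z => (a && z 0) ^^ dot r fun i => z (i + 1)

/-- The assignment that starts with `a` and continues with `z`. -/
def consAssign (a : Bool) (z : ℕ → Bool) : ℕ → Bool
  | 0 => a
  | i + 1 => z i

/-- The entry of the second row at the position of the first `true` of the first row. -/
def pivBit : List Bool → List Bool → Bool
  | true :: _, b :: _ => b
  | false :: R, _ :: r => pivBit R r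
  | _, _ => false

/-- The sum of two rows, truncated or padded to the length of the first one. -/
def addRow : List Bool → List Bool → List Bool
  | a :: r, b :: R => (a ^^ b) :: addRow r R
  | r, _ => r

theorem dot_eq_false {r : List Bool} (h : true ∉ r) (z : ℕ → Bool) : dot r z = false := by
  induction r generalizing z with
  | nil => rfl
  | cons a r ih => cases a <;> simp_all [dot]

theorem length_addRow (r R : List Bool) : (addRow r R).length = r.length := by
  induction r generalizing R with
  | nil => simp [addRow]
  | cons a r ih => cases R <;> simp [addRow, ih]

theorem dot_addRow {r R : List Bool} (h : r.length = R.length) (z : ℕ → Bool) :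
    dot (addRow r R) z = (dot r z ^^ dot R z) := by
  induction r generalizing R z with
  | nil => cases R <;> simp_all [dot, addRow]
  | cons a r ih =>
    obtain _ | ⟨b, R⟩ := R
    · simp at h
    · rw [addRow, dot, dot, dot, ih (by simpa using h)]
      cases a <;> cases b <;> simp [Bool.xor_left_comm]

theorem pivBit_addRow {r R : List Bool} (h : r.length = R.length) :
    pivBit R (addRow r R) = (pivBit R r ^^ pivBit R R) := by
  induction R generalizing r with
  | nil => simp [pivBit]
  | cons b R ih =>
    obtain _ | ⟨a, r⟩ := r
    · simp at h
    · cases b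
      · simpa [pivBit, addRow] using ih (by simpa using h)
      · simp [pivBit, addRow]

theorem pivBit_self (R : List Bool) : pivBit R R = decide (true ∈ R) := by
  induction R with
  | nil => simp [pivBit]
  | cons b R ih => cases b <;> simp [pivBit, ih]

theorem pivBit_nil (R : List Bool) : pivBit R [] = false := by
  obtain _ | ⟨_ | _, R⟩ := R <;> rfl

theorem mem_of_pivBit {R r : List Bool} (h : pivBit R r) : true ∈ R ∧ true ∈ r := by
  induction R generalizing r with
  | nil => simp [pivBit] at h
  | cons b R ih =>
    obtain _ | ⟨a, r⟩ := r
    · simp [pivBit_nil] at h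
    · cases b
      · simpa using (ih h).imp_right (Or.inr (a := true = a))
      · simp_all [pivBit]

theorem mem_addRow_iff {r R : List Bool} (h : r.length = R.length) :
    true ∈ addRow r R ↔ r ≠ R := by
  induction r generalizing R with
  | nil => cases R <;> simp_all [addRow]
  | cons a r ih =>
    obtain _ | ⟨b, R⟩ := R
    · simp at h
    · have := ih (R := R) (by simpa using h)
      cases a <;> cases b <;> simp [addRow, this]

theorem exists_dot_eq {R : List Bool} (hR : true ∈ R) (b : Bool) (z : ℕ → Bool) :
    ∃ z', dot R z' = b ∧ ∀ r, pivBit R r = false → dot r z' = dot r z := by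
  induction R generalizing z with
  | nil => simp at hR
  | cons a R ih =>
    cases a
    · obtain ⟨z', hR', hz'⟩ := ih (by simpa using hR) fun i => z (i + 1)
      refine ⟨consAssign (z 0) z', by simpa [dot, consAssign] using hR', fun r hr => ?_⟩
      obtain _ | ⟨c, r⟩ := r
      · rfl
      · simpa [dot, consAssign] using hz' r hr
    · refine ⟨consAssign (b ^^ dot R fun i => z (i + 1)) fun i => z (i + 1), ?_, fun r hr => ?_⟩
      · simp [dot, consAssign]
      · obtain _ | ⟨c, r⟩ := r
        · rfl
        · obtain rfl : c = false := hr
          simp [dot, consAssign]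

/-- The contribution of the equation to the excess of an assignment. -/
def val (e : Equation) (z : ℕ → Bool) : ℤ := if dot e.row z = e.rhs then e.wt else -e.wt

/-- The average of `Equation.val` over all assignments. -/
def const (e : Equation) : ℤ := if true ∈ e.row then 0 else if e.rhs then -e.wt else e.wt

/-- The equation `e'` with the first variable of `e` eliminated by means of `e`. -/
def elim (e e' : Equation) : Equation :=
  if pivBit e.row e'.row then ⟨addRow e'.row e.row, e'.rhs ^^ e.rhs, e'.wt⟩ else e'

/-- What is left of `e` when it is used to eliminate a variable from itself, written without the
variables, none of which occurs any more. -/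
def reduced (e : Equation) : Equation := ⟨[], e.rhs && decide (true ∉ e.row), e.wt⟩

/-- The equation `e` with `a` substituted for the first variable. -/
def subst (a : Bool) (e : Equation) : Equation :=
  ⟨e.row.tail, e.rhs ^^ (e.row.headD false && a), e.wt⟩

/-- An equation in `n` variables. A row of zeros may be abbreviated to the empty row. -/
def Fits (n : ℕ) (e : Equation) : Prop := e.row = [] ∨ e.row.length = n

variable {e e' : Equation} {n : ℕ} {z : ℕ → Bool}

theorem val_eq_const (h : true ∉ e.row) (z : ℕ → Bool) : e.val z = e.const := by
  rw [val, const, dot_eq_false h, if_neg h]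
  cases e.rhs <;> rfl

theorem val_subst (e : Equation) (z : ℕ → Bool) :
    (e.subst (z 0)).val (fun i => z (i + 1)) = e.val z := by
  obtain ⟨_ | ⟨a, r⟩, b, w⟩ := e
  · simp [val, subst, dot]
  · have hiff : dot r (fun i => z (i + 1)) = (b ^^ (a && z 0)) ↔
        ((a && z 0) ^^ dot r fun i => z (i + 1)) = b := by
      cases a && z 0 <;> cases b <;> simp
    exact if_congr hiff rfl rfl

theorem const_subst (e : Equation) :
    (e.subst false).const + (e.subst true).const = 2 * e.const := by
  obtain ⟨_ | ⟨a, r⟩, b, w⟩ := e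
  · cases b <;> simp [const, subst] <;> ring
  · by_cases hr : true ∈ r
    · simp [const, subst, hr]
    · cases a <;> cases b <;> simp [const, subst, hr] <;> ring

theorem Fits.length_eq_of_pivBit (he : e.Fits n) (he' : e'.Fits n) (h : pivBit e.row e'.row) :
    e'.row.length = e.row.length := by
  obtain ⟨hmem, hmem'⟩ := mem_of_pivBit h
  rw [he.resolve_left (List.ne_nil_of_mem hmem), he'.resolve_left (List.ne_nil_of_mem hmem')]

theorem Fits.elim (he' : e'.Fits n) : (e.elim e').Fits n := by
  unfold Equation.elim
  split
  next h =>
    refine .inr ((length_addRow _ _).trans (he'.resolve_left ?_))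
    exact List.ne_nil_of_mem (mem_of_pivBit h).2
  next => exact he'

theorem val_elim (he : e.Fits n) (he' : e'.Fits n) (hz : dot e.row z = e.rhs) :
    (e.elim e').val z = e'.val z := by
  unfold elim
  split
  next h => simp [val, dot_addRow (he.length_eq_of_pivBit he' h), hz]
  next => rfl

theorem exists_val_elim_eq (he : e.Fits n) (z : ℕ → Bool) :
    ∃ z', ∀ e' : Equation, e'.Fits n → (e.elim e').val z = e'.val z' := by
  by_cases hmem : true ∈ e.row
  · obtain ⟨z', hz', hdot⟩ := exists_dot_eq hmem e.rhs z
    refine ⟨z', fun e' he' => ?_⟩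
    rw [← val_elim he he' hz', val, val, hdot]
    unfold elim
    split
    next h => simp [pivBit_addRow (he.length_eq_of_pivBit he' h), pivBit_self, hmem, h]
    next h => simpa using h
  · refine ⟨z, fun e' _ => ?_⟩
    rw [elim, if_neg fun h => hmem (mem_of_pivBit h).1]

theorem const_elim (he : e.Fits n) (he' : e'.Fits n) (hz : dot e.row z = e.rhs)
    (hmem : true ∈ e.row) :
    (e.elim e').const = e'.const + if e'.row = e.row then e'.val z else 0 := by
  by_cases hrow : e'.row = e.row
  · have hpiv : pivBit e.row e'.row := by simp [hrow, pivBit_self, hmem]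
    have hsum : true ∉ addRow e'.row e.row := fun h =>
      (mem_addRow_iff (congrArg List.length hrow)).1 h hrow
    rw [elim, if_pos hpiv, const, if_neg hsum]
    simp only [const, hrow, hmem, val, hz, if_true, zero_add]
    cases e.rhs <;> cases e'.rhs <;> simp
  · rw [if_neg hrow, add_zero, elim]
    split
    next h =>
      simp [const, mem_addRow_iff (he.length_eq_of_pivBit he' h), hrow, (mem_of_pivBit h).2]
    next => rfl

theorem elim_reduced (e e' : Equation) : e'.elim e.reduced = e.reduced := by
  simp [elim, reduced, pivBit_nil]

theorem not_mem_elim_self (e : Equation) : true ∉ (e.elim e).row := by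
  unfold elim
  split
  next h => simp [mem_addRow_iff]
  next h => simpa [pivBit_self] using h

theorem const_reduced (e : Equation) : e.reduced.const = (e.elim e).const := by
  rw [const, const, if_neg (not_mem_elim_self e), elim]
  by_cases h : true ∈ e.row <;> simp [reduced, pivBit_self, h]

/-- The excess of an assignment. -/
def excess (l : List Equation) (z : ℕ → Bool) : ℤ := (l.map fun e => e.val z).sum

/-- The average excess of an assignment. -/
def score (l : List Equation) : ℤ := (l.map const).sum

/-- The system after an elimination by means of the equation number `j`, if there is one. -/
def elimAt (l : List Equation) (j : ℕ) : List Equation :=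
  match l[j]? with
  | some e => (l.set j e.reduced).map e.elim
  | none => l

theorem exists_score_le_excess (l : List Equation) : ∃ z, score l ≤ excess l z := by
  obtain ⟨n, hn⟩ : ∃ n, ∀ e ∈ l, e.row.length ≤ n :=
    ⟨(l.map fun e => e.row.length).sum, fun e he => List.single_le_sum (by simp) _ (by
      exact List.mem_map_of_mem he)⟩
  induction n generalizing l with
  | zero =>
    refine ⟨fun _ => false, List.sum_le_sum fun e he => (val_eq_const ?_ _).ge⟩
    simp [List.length_eq_zero_iff.1 (Nat.le_zero.1 (hn e he))]
  | succ n ih =>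
    have hsum : score (l.map (subst false)) + score (l.map (subst true)) = 2 * score l := by
      simp only [score, List.map_map, ← List.sum_map_add, ← List.sum_map_mul_left]
      exact congrArg List.sum (List.map_congr_left fun e _ => e.const_subst)
    obtain ⟨a, ha⟩ : ∃ a, score l ≤ score (l.map (subst a)) := by
      by_contra! h
      linarith [h false, h true]
    obtain ⟨z, hz⟩ := ih (l.map (subst a)) (by
      simpa [subst] using fun e he => hn e he)
    refine ⟨consAssign a z, ha.trans (hz.trans_eq ?_)⟩
    simp only [excess, List.map_map]
    exact congrArg List.sum (List.map_congr_left fun e _ => e.val_subst (consAssign a z))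

variable {l : List Equation}

theorem map_elimAt {α : Type} (f : Equation → α) {j : ℕ} (hj : j < l.length)
    (hf : f l[j].reduced = f (l[j].elim l[j])) :
    (elimAt l j).map f = l.map fun e => f (l[j].elim e) := by
  have hset : (l.map fun e => f (l[j].elim e)).set j (f (l[j].elim l[j])) =
      l.map fun e => f (l[j].elim e) := by
    convert List.set_getElem_self (as := l.map fun e => f (l[j].elim e)) (i := j) (by simpa)
    simp
  simp only [elimAt, List.getElem?_eq_getElem hj, List.map_map, List.map_set,
    elim_reduced, hf]
  exact hset

theorem elimAt_of_length_le {j : ℕ} (hj : l.length ≤ j) : elimAt l j = l := by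
  simp [elimAt, List.getElem?_eq_none hj]

theorem length_elimAt (l : List Equation) (j : ℕ) : (elimAt l j).length = l.length := by
  unfold elimAt
  split <;> simp

theorem fits_elimAt (hl : ∀ e ∈ l, e.Fits n) (j : ℕ) : ∀ e ∈ elimAt l j, e.Fits n := by
  unfold elimAt
  split
  next e _ =>
    simp only [List.forall_mem_map]
    intro e' he'
    obtain he' | rfl := List.mem_or_eq_of_mem_set he'
    · exact (hl e' he').elim
    · exact Fits.elim (.inl rfl)
  next => exact hl

theorem score_elimAt {j : ℕ} (hj : j < l.length) :
    score (elimAt l j) = score (l.map l[j].elim) := by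
  rw [score, map_elimAt const hj (const_reduced _), score, List.map_map]
  rfl

theorem excess_elimAt {j : ℕ} (hj : j < l.length) (z : ℕ → Bool) :
    excess (elimAt l j) z = excess (l.map l[j].elim) z := by
  rw [excess, map_elimAt (fun e => e.val z) hj, excess, List.map_map]
  · rfl
  · rw [val_eq_const (not_mem_elim_self _), val_eq_const List.not_mem_nil, const_reduced]

theorem exists_excess_elimAt (hl : ∀ e ∈ l, e.Fits n) (j : ℕ) (z : ℕ → Bool) :
    ∃ z', excess (elimAt l j) z = excess l z' := by
  obtain hj | hj := lt_or_ge j l.length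
  · obtain ⟨z', hz'⟩ := exists_val_elim_eq (hl l[j] (List.getElem_mem hj)) z
    refine ⟨z', ?_⟩
    rw [excess_elimAt hj, excess, List.map_map]
    exact congrArg List.sum (List.map_congr_left fun e he => hz' e (hl e he))
  · exact ⟨z, by rw [elimAt_of_length_le hj]⟩

theorem exists_score_foldl_elimAt_le (hl : ∀ e ∈ l, e.Fits n) (js : List ℕ) :
    ∃ z, score (js.foldl elimAt l) ≤ excess l z := by
  induction js generalizing l with
  | nil => exact exists_score_le_excess l
  | cons j js ih =>
    obtain ⟨z, hz⟩ := ih (fits_elimAt hl j)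
    obtain ⟨z', hz'⟩ := exists_excess_elimAt hl j z
    exact ⟨z', hz.trans_eq hz'⟩

theorem excess_eq_score_add (l : List Equation) (z : ℕ → Bool) :
    excess l z = score l + (l.map fun e => if true ∈ e.row then e.val z else 0).sum := by
  simp only [excess, score, ← List.sum_map_add]
  refine congrArg List.sum (List.map_congr_left fun e _ => ?_)
  by_cases he : true ∈ e.row
  · simp [const, he]
  · simp [val_eq_const he, he]

/-- The equations whose left-hand side is a given nonzero form become constants together, so one
eliminates by means of an equation from a class that contributes positively to the excess. -/
theorem exists_score_elimAt_ge (hl : ∀ e ∈ l, e.Fits n) (h : score l < excess l z) :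
    ∃ j < l.length, score l + 1 ≤ score (elimAt l j) ∧ excess (elimAt l j) z = excess l z := by
  obtain ⟨e, he, hval, hclass⟩ := exists_sum_class_pos row
    (fun e => if true ∈ e.row then e.val z else 0) l (by linarith [excess_eq_score_add l z])
  have hmem : true ∈ e.row := by
    by_contra hmem
    simp [hmem] at hval
  have hsat : dot e.row z = e.rhs := by
    by_contra hsat
    simp only [val, hmem, hsat, if_true, if_false] at hval
    omega
  have hscore : score (l.map e.elim) =
      score l + (l.map fun e' => if e'.row = e.row then e'.val z else 0).sum := by
    simp only [score, List.map_map, ← List.sum_map_add]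
    exact congrArg List.sum (List.map_congr_left fun e' he' =>
      const_elim (hl e he) (hl e' he') hsat hmem)
  have hclass_eq : (l.map fun e' => if e'.row = e.row then
      if true ∈ e'.row then e'.val z else 0 else 0) =
      l.map fun e' => if e'.row = e.row then e'.val z else 0 :=
    List.map_congr_left fun e' _ => by
      by_cases hrow : e'.row = e.row <;> simp [hrow, hmem]
  obtain ⟨j, hj, rfl⟩ := List.mem_iff_getElem.1 he
  refine ⟨j, hj, ?_, ?_⟩
  · rw [hclass_eq] at hclass
    rw [score_elimAt hj, hscore]
    omega
  · rw [excess_elimAt hj, excess, List.map_map]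
    exact congrArg List.sum (List.map_congr_left fun e' he' => val_elim (hl _ he) (hl e' he') hsat)

theorem exists_min_le_score_foldl_elimAt (hl : ∀ e ∈ l, e.Fits n) (z : ℕ → Bool) (k : ℕ) :
    ∃ js : List ℕ, js.length = k ∧ (∀ j ∈ js, j ≤ l.length) ∧
      min (score l + k) (excess l z) ≤ score (js.foldl elimAt l) := by
  induction k generalizing l with
  | zero => exact ⟨[], rfl, by simp, by simp⟩
  | succ k ih =>
    obtain ⟨j, hj, hscore, hexcess⟩ : ∃ j ≤ l.length,
        min (score l + 1) (excess l z) ≤ score (elimAt l j) ∧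
        excess (elimAt l j) z = excess l z := by
      obtain h | h := lt_or_ge (score l) (excess l z)
      · obtain ⟨j, hj, hscore, hexcess⟩ := exists_score_elimAt_ge hl h
        exact ⟨j, hj.le, (min_le_left _ _).trans hscore, hexcess⟩
      · refine ⟨l.length, le_rfl, ?_, ?_⟩ <;> rw [elimAt_of_length_le le_rfl]
        exact (min_le_right _ _).trans h
    obtain ⟨js, hlen, hjs, hmin⟩ := ih (fits_elimAt hl j)
    rw [length_elimAt] at hjs
    refine ⟨j :: js, by simp [hlen], by simpa [hj] using hjs, le_trans ?_ hmin⟩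
    push_cast
    omega

theorem exists_le_score_foldl_elimAt (hl : ∀ e ∈ l, e.Fits n) (h : 0 ≤ score l) {k : ℕ}
    {z : ℕ → Bool} (hz : k ≤ excess l z) : ∃ js : List ℕ, js.length = k ∧
      (∀ j ∈ js, j ≤ l.length) ∧ k ≤ score (js.foldl elimAt l) := by
  obtain ⟨js, hlen, hjs, hmin⟩ := exists_min_le_score_foldl_elimAt hl z k
  exact ⟨js, hlen, hjs, by omega⟩

end Equation

/-! ## Systems as lists of equations -/

namespace Equation

/-- The equations in `n` variables that may occur in a system. -/
structure Valid (n : ℕ) (e : Equation) : Prop where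
  length_row : e.row.length = n
  mem_row : true ∈ e.row
  wt_pos : 0 < e.wt

theorem Valid.fits {n : ℕ} {e : Equation} (he : e.Valid n) : e.Fits n :=
  .inr he.length_row

theorem score_eq_zero_of_valid {n : ℕ} {l : List Equation} (hl : ∀ e ∈ l, e.Valid n) :
    score l = 0 :=
  List.sum_eq_zero <| List.forall_mem_map.2 fun e he => if_pos (hl e he).mem_row

open MaxLinSystem in
/-- The letters that an equation contributes to the word for a system. -/
def letters (e : Equation) : List SysLetter :=
  e.row.map bitLetter ++ bitLetter e.rhs :: (e.wt.bits.map bitLetter ++ [.sep])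

/-- The word for a list of equations in `n` variables. -/
def encode (n : ℕ) (l : List Equation) : List SysLetter :=
  List.replicate n .one ++ .sep :: l.flatMap letters

theorem Valid.four_le_length_letters {n : ℕ} {e : Equation} (he : e.Valid n) :
    4 ≤ e.letters.length := by
  have hrow := List.length_pos_of_mem he.mem_row
  have hbits := (Nat.size_pos.2 he.wt_pos).trans_eq e.wt.size_eq_bits_len.symm
  simp only [letters, List.length_append, List.length_map, List.length_cons, List.length_nil]
  omega

theorem length_lt_two_pow_log_length_encode {n : ℕ} {l : List Equation}
    (hl : ∀ e ∈ l, e.Valid n) : l.length < 2 ^ Nat.log 2 (encode n l).length := by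
  have hletters : l.length * 4 ≤ (l.map fun e => e.letters.length).sum := by
    simpa using List.card_nsmul_le_sum (l.map fun e => e.letters.length) 4
      (List.forall_mem_map.2 fun e he => (hl e he).four_le_length_letters)
  have hlog := Nat.lt_pow_succ_log_self one_lt_two (encode n l).length
  rw [pow_succ] at hlog
  simp only [encode, List.length_append, List.length_cons, List.length_flatMap] at hlog ⊢
  omega

end Equation

namespace MaxLinSystem

open Equation

/-- The equations of a system. -/
def equations (S : MaxLinSystem) : List Equation :=
  List.ofFn fun j => ⟨List.ofFn fun i => decide (S.A j i ≠ 0), decide (S.b j ≠ 0), S.w j⟩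

theorem encode_eq (S : MaxLinSystem) : S.encode = Equation.encode S.n S.equations := by
  have hletter (a : ZMod 2) : coeffLetter a = bitLetter (decide (a ≠ 0)) := by
    by_cases ha : a = 0 <;> simp [coeffLetter, bitLetter, ha]
  have heq : S.encodeEq = fun j =>
      letters ⟨List.ofFn fun i => decide (S.A j i ≠ 0), decide (S.b j ≠ 0), S.w j⟩ := by
    funext j
    simp only [encodeEq, letters, hletter, List.map_ofFn]
    rfl
  simp only [encode, heq, Equation.encode, equations, List.flatMap, List.map_ofFn]
  rfl

theorem valid_equations (S : MaxLinSystem) : ∀ e ∈ S.equations, e.Valid S.n := by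
  intro e he
  obtain ⟨j, rfl⟩ := (List.mem_ofFn' _ _).1 he
  obtain ⟨i, hi⟩ := Function.ne_iff.1 (S.row_ne_zero j)
  exact ⟨by simp, (List.mem_ofFn' _ _).2 ⟨i, by simpa using hi⟩, S.w_pos j⟩

theorem exists_equations_eq {n : ℕ} {l : List Equation} (hl : ∀ e ∈ l, e.Valid n) :
    ∃ S : MaxLinSystem, S.n = n ∧ S.equations = l := by
  have hbit (b : Bool) : decide ((if b then (1 : ZMod 2) else 0) ≠ 0) = b := by cases b <;> decide
  refine ⟨⟨n, l.length, fun j i => if l[j].row.getD i false then 1 else 0,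
    fun j => if l[j].rhs then 1 else 0, fun j => l[j].wt,
    fun j => (hl _ (List.getElem_mem _)).wt_pos, fun j => ?_⟩, rfl, ?_⟩
  · obtain ⟨hlen, hmem, -⟩ := hl l[j] (List.getElem_mem _)
    obtain ⟨i, hi, hget⟩ := List.mem_iff_getElem.1 hmem
    refine Function.ne_iff.2 ⟨⟨i, hlen ▸ hi⟩, ?_⟩
    simp only [List.getD_eq_getElem _ _ hi, hget]
    simp
  · refine List.ext_getElem (by simp [equations]) fun j _ hj => ?_
    have hlen := (hl _ (List.getElem_mem hj)).length_row
    have hrow : (List.ofFn fun i : Fin n => l[j].row.getD i false) = l[j].row :=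
      List.ext_getElem (by simpa using hlen.symm) fun i _ hi => by simp [hi]
    simp only [equations, List.getElem_ofFn, hbit, Fin.getElem_fin, hrow]

theorem dot_ofFn {n : ℕ} (a : Fin n → ZMod 2) (z : ℕ → Bool) :
    dot (List.ofFn fun i => decide (a i ≠ 0)) z =
      decide (∑ i, a i * (if z i then 1 else 0) ≠ 0) := by
  induction n generalizing z with
  | zero => simp [dot]
  | succ n ih =>
    have hadd : ∀ x y : ZMod 2, (decide (x ≠ 0) ^^ decide (y ≠ 0)) = decide (x + y ≠ 0) := by
      decide
    have hmul (b : Bool) : (decide (a 0 ≠ 0) && b) = decide (a 0 * (if b then 1 else 0) ≠ 0) := by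
      cases b <;> simp
    rw [List.ofFn_succ, dot, ih fun i => a i.succ, Fin.sum_univ_succ, ← hadd, hmul]
    rfl

theorem excess_equations (S : MaxLinSystem) (z : ℕ → Bool) :
    Equation.excess S.equations z = S.excess fun i => if z i then 1 else 0 := by
  have hval (j : Fin S.m) : S.A.mulVec (fun i => if z i then 1 else 0) j = S.b j ↔
      dot (List.ofFn fun i => decide (S.A j i ≠ 0)) z = decide (S.b j ≠ 0) := by
    have hinj : ∀ x y : ZMod 2, x = y ↔ decide (x ≠ 0) = decide (y ≠ 0) := by decide
    rw [dot_ofFn, hinj]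
    rfl
  simp only [excess, Equation.excess, equations, List.map_ofFn, List.sum_ofFn, ne_eq]
  rw [Finset.sum_filter, Finset.sum_filter, ← Finset.sum_sub_distrib]
  refine Finset.sum_congr rfl fun j _ => ?_
  by_cases hj : S.A.mulVec (fun i => if z i then 1 else 0) j = S.b j
  · rw [Function.comp, val, if_pos ((hval j).1 hj), if_pos hj, if_neg (not_not.2 hj), sub_zero]
  · rw [Function.comp, val, if_neg (mt (hval j).2 hj), if_neg hj, if_pos hj, zero_sub]

theorem le_maxExcess_iff (S : MaxLinSystem) (k : ℤ) :
    k ≤ S.maxExcess ↔ ∃ z, k ≤ Equation.excess S.equations z := by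
  rw [maxExcess, Finset.le_sup'_iff]
  constructor
  · rintro ⟨z, -, hz⟩
    refine ⟨fun i => if h : i < S.n then decide (z ⟨i, h⟩ ≠ 0) else false, ?_⟩
    rw [excess_equations]
    refine hz.trans_eq (congrArg S.excess (funext fun i => ?_))
    have hbit : ∀ x : ZMod 2, (if x = 0 then (0 : ZMod 2) else 1) = x := by decide
    simp [hbit]
  · rintro ⟨z, hz⟩
    exact ⟨_, Finset.mem_univ _, excess_equations S z ▸ hz⟩

end MaxLinSystem

theorem mem_maxLinAA_iff (x : List SysLetter) (k : ℕ) :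
    (x, k) ∈ MaxLinAA ↔ ∃ (n : ℕ) (l : List Equation), (∀ e ∈ l, e.Valid n) ∧
      x = Equation.encode n l ∧ ∃ z, k ≤ Equation.excess l z := by
  constructor
  · rintro ⟨S, hx, hk⟩
    exact ⟨S.n, S.equations, S.valid_equations, hx.trans S.encode_eq, (S.le_maxExcess_iff k).1 hk⟩
  · rintro ⟨n, l, hl, hx, hz⟩
    obtain ⟨S, rfl, rfl⟩ := MaxLinSystem.exists_equations_eq hl
    exact ⟨S, hx.trans S.encode_eq.symm, (S.le_maxExcess_iff k).2 hz⟩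

/-! ## Binary numerals -/

/-- The number with the given binary digits, the least significant one first. -/
def ofBits (l : List Bool) : ℕ := l.foldr Nat.bit 0

theorem ofBits_cons (b : Bool) (l : List Bool) : ofBits (b :: l) = 2 * ofBits l + b.toNat :=
  Nat.bit_val _ _

theorem ofBits_append (l l' : List Bool) :
    ofBits (l ++ l') = ofBits l + 2 ^ l.length * ofBits l' := by
  induction l with
  | nil => simp [ofBits]
  | cons b l ih =>
    rw [List.cons_append, ofBits_cons, ofBits_cons, ih, List.length_cons]
    ring

theorem ofBits_lt_two_pow (l : List Bool) : ofBits l < 2 ^ l.length := by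
  induction l with
  | nil => simp [ofBits]
  | cons b l ih =>
    have := b.toNat_lt
    rw [ofBits_cons, List.length_cons, pow_succ]
    omega

theorem ofBits_eq_of_testBit {m j : ℕ} (hj : j < 2 ^ m) :
    ofBits ((List.range m).map j.testBit) = j := by
  induction m generalizing j with
  | zero => simp_all [ofBits]
  | succ m ih =>
    have := ih (j := j / 2) (by omega)
    rw [List.range_succ_eq_map, List.map_cons, List.map_map, ofBits_cons]
    simp only [Function.comp_def, Nat.testBit_succ, this, Nat.testBit_zero]
    rcases Nat.mod_two_eq_zero_or_one j with h | h <;> simp [h] <;> omega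

theorem ofBits_bits (n : ℕ) : ofBits n.bits = n := by
  induction n using Nat.binaryRec' with
  | zero => simp [ofBits]
  | bit b n h ih => rw [Nat.bits_append_bit n b h, ofBits_cons, ih, Nat.bit_val]

theorem getLast?_bits {n : ℕ} (hn : 0 < n) : n.bits.getLast? = some true := by
  induction n using Nat.binaryRec' with
  | zero => simp at hn
  | bit b n h ih =>
    rw [Nat.bits_append_bit n b h]
    obtain rfl | hn := Nat.eq_zero_or_pos n
    · simp [h rfl]
    · rw [List.getLast?_cons, ih hn, Option.getD_some]

theorem ofBits_pos {l : List Bool} (h : l.getLast? = some true) : 0 < ofBits l := by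
  obtain ⟨l, rfl⟩ := List.getLast?_eq_some_iff.1 h
  rw [ofBits_append]
  simp [ofBits]

theorem bits_ofBits {l : List Bool} (h : l.getLast? = some true) : (ofBits l).bits = l := by
  induction l with
  | nil => simp at h
  | cons b l ih =>
    obtain rfl | hl := eq_or_ne l []
    · obtain rfl : b = true := by simpa using h
      simp [ofBits]
    · have hlast : l.getLast? = some true := by
        rwa [← List.singleton_append, List.getLast?_append_of_ne_nil _ hl] at h
      rw [ofBits, List.foldr_cons, Nat.bits_append_bit _ _ fun h0 => ?_, ← ofBits, ih hlast]
      exact absurd h0 (ofBits_pos hlast).ne'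

/-- Binary addition of a numeral that repeats the digit `y`, for an incoming carry: the digits of
the sum and the outgoing carry. -/
def ripple (y : Bool) : Bool → List Bool → List Bool × Bool
  | c, [] => ([], c)
  | c, x :: l => ((x ^^ y ^^ c) :: (ripple y (x.atLeastTwo y c) l).1,
      (ripple y (x.atLeastTwo y c) l).2)

theorem length_ripple (y c : Bool) (l : List Bool) : (ripple y c l).1.length = l.length := by
  induction l generalizing c with
  | nil => rfl
  | cons x l ih => simp [ripple, ih]

theorem ofBits_ripple (y c : Bool) (l : List Bool) :
    ofBits (ripple y c l).1 + 2 ^ l.length * (ripple y c l).2.toNat + y.toNat =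
      ofBits l + c.toNat + 2 ^ l.length * y.toNat := by
  induction l generalizing c with
  | nil => simp [ripple, ofBits]
  | cons x l ih =>
    have := ih (x.atLeastTwo y c)
    simp only [ripple, ofBits_cons, List.length_cons, pow_succ]
    cases x <;> cases y <;> cases c <;> simp [Bool.atLeastTwo] at this ⊢ <;> linarith

theorem ripple_true_snd (l : List Bool) : (ripple true false l).2 = decide (ofBits l ≠ 0) := by
  have hripple := ofBits_ripple true false l
  have hlt := ofBits_lt_two_pow (ripple true false l).1
  rw [length_ripple] at hlt
  cases hcarry : (ripple true false l).2 <;> simp [hcarry] at hripple ⊢ <;> omega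

theorem ofBits_ripple_true {l : List Bool} (h : ofBits l ≠ 0) :
    ofBits (ripple true false l).1 = ofBits l - 1 := by
  have hripple := ofBits_ripple true false l
  simp [ripple_true_snd, h] at hripple
  omega

/-- Binary addition of a carry. -/
def addCarry (c : Bool) (l : List Bool) : List Bool :=
  (ripple false c l).1 ++ if (ripple false c l).2 then [true] else []

theorem ofBits_addCarry (c : Bool) (l : List Bool) :
    ofBits (addCarry c l) = ofBits l + c.toNat := by
  have hripple := ofBits_ripple false c l
  rw [addCarry, ofBits_append, length_ripple]
  cases hcarry : (ripple false c l).2 <;> simpa [hcarry, ofBits] using hripple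

theorem addCarry_bits (c : Bool) (n : ℕ) : addCarry c n.bits = (n + c.toNat).bits := by
  induction n using Nat.binaryRec' generalizing c with
  | zero => cases c <;> simp [addCarry, ripple]
  | bit b n h ih =>
    have hcons (l : List Bool) : addCarry c (b :: l) = (b ^^ c) :: addCarry (b && c) l := by
      cases b <;> cases c <;> rfl
    have hbit : n.bit b + c.toNat = (n + (b && c).toNat).bit (b ^^ c) := by
      cases b <;> cases c <;> simp +arith [Nat.bit_val]
    rw [Nat.bits_append_bit n b h, hcons, ih, hbit, Nat.bits_append_bit]
    intro h0
    have hb := h (Nat.eq_zero_of_add_eq_zero_right h0)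
    cases c <;> simp_all

theorem ofBits_eq_zero_iff (l : List Bool) : ofBits l = 0 ↔ true ∉ l := by
  induction l with
  | nil => simp [ofBits]
  | cons b l ih => cases b <;> simp [ofBits_cons, ih]

/-- Binary addition of two numerals and a carry. -/
def addBits : Bool → List Bool → List Bool → List Bool
  | c, l, [] => addCarry c l
  | c, l, b :: w => (l.headD false ^^ b ^^ c) :: addBits ((l.headD false).atLeastTwo b c) l.tail w

theorem ofBits_addBits (c : Bool) (l w : List Bool) :
    ofBits (addBits c l w) = ofBits l + ofBits w + c.toNat := by
  induction w generalizing c l with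
  | nil => rw [addBits, ofBits_addCarry]; rfl
  | cons b w ih =>
    rw [addBits, ofBits_cons, ih, ofBits_cons]
    obtain _ | ⟨x, l⟩ := l
    · cases b <;> cases c <;> simp +arith [ofBits, Bool.atLeastTwo]
    · cases x <;> cases b <;> cases c <;> simp +arith [ofBits_cons, Bool.atLeastTwo]

/-- Comparison of two numerals from the least significant digit on, where `g` is the outcome for
the digits that have been removed already. -/
def geBits : Bool → List Bool → List Bool → Bool
  | g, [], l' => g && decide (true ∉ l')
  | g, a :: l, l' => geBits (if a = l'.headD false then g else a) l l'.tail

theorem geBits_iff (g : Bool) (l l' : List Bool) :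
    geBits g l l' ↔ ofBits l' < ofBits l + g.toNat := by
  induction l generalizing g l' with
  | nil => cases g <;> simp [geBits, ← ofBits_eq_zero_iff, ofBits]
  | cons a l ih =>
    obtain _ | ⟨b, l'⟩ := l'
    · rw [geBits, ih, ofBits_cons]
      cases a <;> cases g <;> simp [ofBits]
    · rw [geBits, ih, ofBits_cons, ofBits_cons]
      cases a <;> cases b <;> cases g <;> simp <;> omega

/-! ## Parsing -/

/-- The state of a parser for words of systems of linear equations: the number `n` of variables,
the equations `l` read so far, and the parts of the equation that is being read. -/
inductive Parse
  | header (n : ℕ)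
  | row (n : ℕ) (l : List Equation) (r : List Bool)
  | weight (n : ℕ) (l : List Equation) (r : List Bool) (b : Bool) (w : List Bool)
  | bad

namespace Parse

open Equation
open MaxLinSystem (bitLetter)

/-- The parser state after a binary digit. -/
def bit (b : Bool) : Parse → Parse
  | header n => if b then header (n + 1) else bad
  | row n l r =>
    if r.length < n then row n l (r ++ [b]) else if true ∈ r then weight n l r b [] else bad
  | weight n l r c w => weight n l r c (w ++ [b])
  | bad => bad

/-- The parser state after a separator. -/
def sep : Parse → Parse
  | header n => row n [] []
  | row _ _ _ => bad
  | weight n l r b w => if w.getLast? = some true then row n (l ++ [⟨r, b, ofBits w⟩]) [] else bad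
  | bad => bad

/-- The parser state after another letter. -/
def next (p : Parse) : SysLetter → Parse
  | .zero => p.bit false
  | .one => p.bit true
  | .sep => p.sep

/-- The parser state after a word. -/
def parse (x : List SysLetter) : Parse := x.foldl next (header 0)

@[simp] theorem next_bitLetter (p : Parse) (b : Bool) : p.next (bitLetter b) = p.bit b := by
  cases b <;> rfl

theorem foldl_bit_row {n : ℕ} (l : List Equation) (r₀ r : List Bool)
    (h : r₀.length + r.length ≤ n) :
    (r.map bitLetter).foldl next (row n l r₀) = row n l (r₀ ++ r) := by
  induction r generalizing r₀ with
  | nil => simp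
  | cons b r ih =>
    rw [List.length_cons] at h
    rw [List.map_cons, List.foldl_cons, next_bitLetter, bit, if_pos (by omega),
      ih _ (by simp; omega), List.append_assoc, List.singleton_append]

theorem foldl_bit_weight (n : ℕ) (l : List Equation) (r : List Bool) (b : Bool)
    (w₀ w : List Bool) :
    (w.map bitLetter).foldl next (weight n l r b w₀) = weight n l r b (w₀ ++ w) := by
  induction w generalizing w₀ with
  | nil => simp
  | cons c w ih => simp [bit, ih]

theorem foldl_letters {n : ℕ} (l : List Equation) {e : Equation} (he : e.Valid n) :
    e.letters.foldl next (row n l []) = row n (l ++ [e]) [] := by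
  have hrow := foldl_bit_row l [] e.row (n := n) (by simp [he.length_row])
  have hend : bit e.rhs (row n l e.row) = weight n l e.row e.rhs [] := by
    rw [bit, if_neg he.length_row.not_lt, if_pos he.mem_row]
  have hweight := foldl_bit_weight n l e.row e.rhs [] e.wt.bits
  rw [List.nil_append] at hrow hweight
  rw [letters, List.foldl_append, hrow, List.foldl_cons, next_bitLetter, hend, List.foldl_append,
    hweight]
  simp [next, sep, getLast?_bits he.wt_pos, ofBits_bits]

theorem parse_encode {n : ℕ} {l : List Equation} (hl : ∀ e ∈ l, e.Valid n) :
    parse (encode n l) = row n l [] := by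
  have hheader (m : ℕ) : (List.replicate m SysLetter.one).foldl next (header 0) = header m := by
    induction m with
    | zero => rfl
    | succ m ih => rw [List.replicate_succ', List.foldl_concat, ih]; rfl
  have hequations (l₀ : List Equation) :
      (l.flatMap letters).foldl next (row n l₀ []) = row n (l₀ ++ l) [] := by
    induction l generalizing l₀ with
    | nil => simp
    | cons e l ih =>
      rw [List.forall_mem_cons] at hl
      rw [List.flatMap_cons, List.foldl_append, foldl_letters l₀ hl.1, ih hl.2, List.append_assoc,
        List.singleton_append]
  rw [parse, encode, List.foldl_append, hheader, List.foldl_cons]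
  exact hequations []

/-- The word `x` leads to the given parser state. -/
def Reads (x : List SysLetter) : Parse → Prop
  | header n => x = List.replicate n .one
  | row n l r => (∀ e ∈ l, e.Valid n) ∧ r.length ≤ n ∧ x = encode n l ++ r.map bitLetter
  | weight n l r b w => (∀ e ∈ l, e.Valid n) ∧ r.length = n ∧ true ∈ r ∧
      x = encode n l ++ r.map bitLetter ++ bitLetter b :: w.map bitLetter
  | bad => True

theorem Reads.bit {x : List SysLetter} {p : Parse} (h : p.Reads x) (b : Bool) :
    (p.bit b).Reads (x ++ [bitLetter b]) := by
  cases p with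
  | header n =>
    cases b
    · trivial
    · simp_all [Parse.bit, Reads, bitLetter, List.replicate_succ']
  | row n l r =>
    obtain ⟨hl, hr, rfl⟩ := h
    rw [Parse.bit]
    split_ifs with hlt hmem
    · exact ⟨hl, by simpa using hlt, by simp⟩
    · exact ⟨hl, by omega, hmem, by simp⟩
    · trivial
  | weight n l r c w =>
    obtain ⟨hl, hr, hmem, rfl⟩ := h
    exact ⟨hl, hr, hmem, by simp⟩
  | bad => trivial

theorem Reads.sep {x : List SysLetter} {p : Parse} (h : p.Reads x) : p.sep.Reads (x ++ [.sep]) := by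
  cases p with
  | header n =>
    obtain rfl := h
    exact ⟨by simp, by simp, by simp [encode]⟩
  | row n l r => trivial
  | weight n l r b w =>
    obtain ⟨hl, hr, hmem, rfl⟩ := h
    rw [Parse.sep]
    split_ifs with hw
    · refine ⟨?_, by simp, by simp [encode, letters, bits_ofBits hw]⟩
      simpa [or_imp, forall_and] using ⟨hl, ⟨hr, hmem, ofBits_pos hw⟩⟩
    · trivial
  | bad => trivial

theorem reads_parse (x : List SysLetter) : (parse x).Reads x := by
  induction x using List.reverseRecOn with
  | nil => rfl
  | append_singleton x a ih =>
    rw [parse, List.foldl_concat]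
    cases a
    · exact ih.bit false
    · exact ih.bit true
    · exact ih.sep

theorem parse_eq_row_iff {x : List SysLetter} {n : ℕ} {l : List Equation} :
    parse x = row n l [] ↔ (∀ e ∈ l, e.Valid n) ∧ x = encode n l := by
  constructor
  · intro h
    obtain ⟨hl, -, hx⟩ := h ▸ reads_parse x
    exact ⟨hl, by simpa using hx⟩
  · rintro ⟨hl, rfl⟩
    exact parse_encode hl

end Parse

/-! ## A program for Max Lin AA -/

namespace MaxLinAA

/-- The letters on the tapes of the program. The letters `sep` and `digit` also serve to present the
input word, and `tick` serves for numbers in unary. -/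
inductive Sym
  | tick
  | sep
  | coef (b : Bool)
  | rhs (b : Bool)
  | digit (b : Bool)
  deriving Fintype

/-- The tapes of the program. Numbers on `index`, `pos` and `neg` are in binary, the number on
`param` is in unary; `out` and `aux` collect the letters that replace those of another tape. -/
inductive Tape
  | input
  | eqns
  | out
  | pivot
  | spare
  | index
  | param
  | pos
  | neg
  | aux
  deriving DecidableEq

instance : Fintype Tape where
  elems := {.input, .eqns, .out, .pivot, .spare, .index, .param, .pos, .neg, .aux}
  complete := by rintro (_ | _) <;> simp

/-- The parts of the input word, see `Parse`. -/
inductive Phase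
  | header
  | row
  | weight
  | bad
  deriving DecidableEq

instance : Fintype Phase where
  elems := {.header, .row, .weight, .bad}
  complete := by rintro (_ | _) <;> simp

set_option synthInstance.maxSize 2000 in
-- the derived `Fintype` instance goes through a nested product of the nine fields
/-- The internal memory of the program. In the current row, `nz` records a true coefficient and
`piv` the bit to be eliminated, once a true coefficient of the pivot row has fixed it; `top` is the
last weight digit read. In the search for the guessed equation, `found` stays true once it has been
reached and `copying` is true inside it. The outcome of the comparison so far is `ge`. -/
structure Reg where
  phase : Phase := .header
  nz : Bool := false
  top : Bool := false
  rhs : Bool := false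
  carry : Bool := false
  found : Bool := false
  copying : Bool := false
  piv : Option Bool := none
  ge : Bool := false
  deriving Fintype

/-- Programs for the tapes, letters and memory above. -/
abbrev Program : Type := Prog Tape Sym Reg

infixr:60 " ;; " => Prog.seq

namespace Sym

/-- The bit that a letter carries. -/
def bit : Sym → Bool
  | coef b | rhs b | digit b => b
  | _ => false

end Sym

/-! ### Moving letters and adding numbers -/

/-- The program without effect. -/
def skip : Program := .load id

/-- Push a fixed letter. -/
def emit (k : Tape) (a : Sym) : Program := .push k fun _ => a

/-- Empty a tape. -/
def clear (k : Tape) : Program := .forEach k fun _ => skip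

/-- Empty one tape onto another, which reverses the order of its letters. -/
def move (k k' : Tape) : Program := .forEach k (emit k')

/-- One column of a binary addition; the digits of the sum are collected on `aux`. -/
def fullAdd (x y : Bool) : Program :=
  .push .aux (fun r => .digit (x ^^ y ^^ r.carry)) ;;
  .load fun r => { r with carry := x.atLeastTwo y r.carry }

/-- Add the carry to the number on `k`, and the digit `y` in every column, from the least
significant digit on top of the tape. -/
def rippleAdd (y : Bool) (k : Tape) : Program := .forEach k fun a => fullAdd a.bit y

/-- Complete an addition to the number on `k`, of which the lowest digits of the sum are on
`aux` already: propagate the carry, append it as a new digit if necessary, and move the sum back. -/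
def flush (k : Tape) : Program :=
  rippleAdd false k ;; .ite (·.carry) (emit .aux (.digit true)) skip ;; move .aux k ;;
  .load fun r => { r with carry := false }

/-- Increment the number on `k`. -/
def incr (k : Tape) : Program :=
  .load (fun r => { r with carry := true }) ;; flush k

/-- Decrement the number on `k` by adding `-1`, all of whose digits are true; no carry is left
exactly when the number was zero. -/
def decr (k : Tape) : Program :=
  .load (fun r => { r with carry := false }) ;; rippleAdd true k ;; move .aux k

/-- Add the digit `b` to the next digit of the number on `k`, which is read as `0` past its end. -/
def addDigit (k : Tape) (b : Bool) : Program := .pop k fun a => fullAdd (a.elim false Sym.bit) b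

/-! ### Reading the input -/

/-- Distinguish the header, the rows and the weights of the input word. -/
def byPhase (p q p' : Program) : Program :=
  .ite (·.phase = .header) p <| .ite (·.phase = .row) q <| .ite (·.phase = .weight) p' skip

/-- Start the phase `ph` with the rest of the memory reset. -/
def enter (ph : Phase) : Program := .load fun _ => { phase := ph }

/-- Read a bit of the input word. The ticks on `pivot` count the variables that the row still
lacks and those on `spare` the variables it has already. -/
def readBit (b : Bool) : Program :=
  byPhase
    (bif b then emit .pivot .tick else enter .bad)
    (.pop .pivot fun
      | some _ => emit .spare .tick ;; emit .out (.coef b) ;;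
          .load fun r => { r with nz := r.nz || b }
      | none => .ite (·.nz) (emit .out (.rhs b) ;; move .spare .pivot ;; enter .weight)
          (enter .bad))
    (emit .out (.digit b) ;; .load fun r => { r with top := b })

/-- Read a separator of the input word. -/
def readSep : Program :=
  byPhase (enter .row) (enter .bad) (.ite (·.top) (emit .out .sep ;; enter .row) (enter .bad))

/-- Read a letter of the input: count it, on `index` if it belongs to the word and on `param`
and `neg` if it belongs to the parameter, and parse it. -/
def readLetter : Sym → Program
  | .tick => emit .param .tick ;; incr .neg
  | .sep => incr .index ;; readSep
  | .digit b => incr .index ;; readBit b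
  | _ => skip

/-- Reject a word that ends within a row, drop the top digit of `index`, which leaves the `log₂`
of the length of the word many digits, and tidy the tapes. -/
def finish : Program :=
  .pop .spare (fun a => a.elim skip fun _ => enter .bad) ;;
  .pop .index (fun _ => skip) ;; clear .pivot ;; move .out .eqns ;;
  .load fun r => { phase := r.phase }

/-- Parse the input. -/
def read : Program := .forEach .input readLetter ;; finish

/-! ### Rounds of elimination -/

/-- Guess the number of an equation, digit by digit, on `index`. -/
def guess : Program :=
  .forEach .index (fun _ => .flip fun b => emit .aux (.digit b)) ;; move .aux .index

/-- Pass to the next equation. The equation sought has been reached when `index` is zero, which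
the missing carry of its decrement reveals. -/
def advance : Program :=
  .ite (·.found) (.load fun r => { r with copying := false }) <|
    decr .index ;; .load fun r => { r with copying := !r.carry, found := !r.carry }

/-- Copy an equation, except for the one sought, whose row goes to `spare` and whose right-hand
side goes to the memory; what is left of it is an equation with empty row. -/
def extractLetter : Sym → Program
  | .sep => emit .out .sep ;; advance
  | .coef b => .ite (·.copying)
      (emit .spare (.coef b) ;; .load fun r => { r with nz := r.nz || b }) (emit .out (.coef b))
  | .rhs b => .ite (·.copying)
      ((.push .out fun r => .rhs (b && !r.nz)) ;; .load fun r => { r with rhs := b })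
      (emit .out (.rhs b))
  | a => emit .out a

/-- Put the row of the guessed equation on `pivot` and leave its reduced form in the system. -/
def extract : Program :=
  advance ;; .forEach .eqns extractLetter ;; move .out .eqns ;; move .spare .pivot

/-- Add the pivot equation to the current one if the latter has a true coefficient at the first
variable of the pivot row. -/
def elimLetter : Sym → Program
  | .coef b => .pop .pivot fun
      | some a => .load (fun r => { r with piv := r.piv.or (bif a.bit then some b else none) }) ;;
          (.push .out fun r => .coef (b ^^ (a.bit && r.piv == some true))) ;; emit .spare a
      | none => emit .out (.coef b)
  | .rhs b => (.push .out fun r => .rhs (b ^^ (r.piv == some true && r.rhs))) ;;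
      .load (fun r => { r with piv := none }) ;; move .spare .pivot
  | a => emit .out a

/-- Eliminate the first variable of the pivot row from all equations. -/
def eliminate : Program :=
  .forEach .eqns elimLetter ;; move .out .eqns ;; clear .pivot ;;
  .load fun r => { phase := r.phase }

/-- Guess an equation and eliminate with it, as often as the parameter says. -/
def rounds : Program := .forEach .param fun _ => guess ;; extract ;; eliminate

/-! ### Evaluating the resulting system -/

/-- Evaluate the system at the zero assignment: add the weights of the equations without
variables to `pos` if they are satisfied and to `neg`, which starts from the parameter, if not. -/
def evalLetter : Sym → Program
  | .coef b => .load fun r => { r with nz := r.nz || b }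
  | .rhs b => .load fun r => { r with rhs := b }
  | .digit b => .ite (·.nz) skip (.ite (·.rhs) (addDigit .neg b) (addDigit .pos b))
  | _ => .ite (·.nz) skip (.ite (·.rhs) (flush .neg) (flush .pos)) ;;
      .load fun r => { phase := r.phase }

/-- Compare the digit `a` of `pos` with the next digit of `neg`, from the least significant one. -/
def compareDigit (a : Bool) : Program :=
  .pop .neg fun b => .load fun r =>
    { r with ge := if a = b.elim false Sym.bit then r.ge else a }

/-- Decide whether the number on `pos` is at least the number on `neg`. -/
def compare : Program :=
  .load (fun r => { r with ge := true }) ;; (.forEach .pos fun a => compareDigit a.bit) ;;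
  .forEach .neg fun a => .load fun r => { r with ge := r.ge && !a.bit }

/-- The program for Max Lin AA. -/
def program : Program :=
  read ;; .ite (·.phase = .row) (rounds ;; .forEach .eqns evalLetter ;; compare) skip

theorem wellFormed_program : program.wellFormed := by
  decide

/-! ### Running the programs -/

/-- The states of the program. -/
abbrev State : Type := Prog.State Tape Sym Reg

section Basic

variable {o : ℕ → Bool}

/-- The effect of the loop body `p` on the letters `l` in succession. -/
def feed (o : ℕ → Bool) (p : Sym → Program) (l : List Sym) (s : State) : State :=
  l.foldl (fun s a => (p a).run o s) s

theorem run_forEach (k : Tape) (p : Sym → Program) (s : State) :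
    Prog.run o (.forEach k p) s = feed o p (s.tape k) (s.setTape k []) := rfl

theorem run_seq (p q : Program) (s : State) :
    (p ;; q).run o s = q.run o (p.run o s) := rfl

theorem run_skip (s : State) : skip.run o s = s := rfl

@[simp] theorem feed_nil (p : Sym → Program) (s : State) :
    feed o p [] s = s := rfl

@[simp] theorem feed_cons (p : Sym → Program) (a : Sym) (l : List Sym)
    (s : State) : feed o p (a :: l) s = feed o p l ((p a).run o s) := rfl

theorem feed_append (p : Sym → Program) (l l' : List Sym) (s : State) :
    feed o p (l ++ l') s = feed o p l' (feed o p l s) :=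
  List.foldl_append

theorem run_move {k k' : Tape} (h : k ≠ k') (s : State) :
    (move k k').run o s =
      (s.setTape k []).setTape k' ((s.tape k).reverse ++ s.tape k') := by
  have hfeed (l : List Sym) (s : State) :
      feed o (emit k') l s = s.setTape k' (l.reverse ++ s.tape k') := by
    induction l generalizing s with
    | nil => exact (Prog.State.setTape_self rfl).symm
    | cons a l ih => simp [ih, emit, Prog.run]
  rw [move, run_forEach, hfeed, Prog.State.tape_setTape_of_ne h.symm]

theorem run_clear (k : Tape) (s : State) :
    (clear k).run o s = s.setTape k [] := by
  have hfeed (l : List Sym) (s : State) : feed o (fun _ => skip) l s = s := by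
    induction l with
    | nil => rfl
    | cons _ _ ih => exact ih
  rw [clear, run_forEach, hfeed]

/-- The state `s` with the given carry. -/
def setCarry (c : Bool) (s : State) : State :=
  { s with reg := { s.reg with carry := c } }

theorem run_fullAdd (x y : Bool) (s : State) :
    (fullAdd x y).run o s = setCarry (x.atLeastTwo y s.reg.carry)
      (s.setTape .aux (.digit (x ^^ y ^^ s.reg.carry) :: s.tape .aux)) := rfl

theorem run_rippleAdd (y : Bool) {k : Tape} {l : List Bool} {s : State}
    (hk : k ≠ .aux) (hl : s.tape k = l.map .digit) :
    (rippleAdd y k).run o s = setCarry (ripple y s.reg.carry l).2 ((s.setTape k []).setTape .aux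
      (((ripple y s.reg.carry l).1.map .digit).reverse ++ s.tape .aux)) := by
  have hfeed (s : State) :
      feed o (fun a => fullAdd a.bit y) (l.map .digit) s = setCarry (ripple y s.reg.carry l).2
        (s.setTape .aux (((ripple y s.reg.carry l).1.map .digit).reverse ++ s.tape .aux)) := by
    clear hl
    induction l generalizing s with
    | nil => simp [ripple, Prog.State.setTape_self, setCarry]
    | cons x l ih =>
      rw [List.map_cons, feed_cons, ih, run_fullAdd]
      simp [setCarry, Prog.State.setTape, ripple, Sym.bit]
  rw [rippleAdd, run_forEach, hl, hfeed, Prog.State.tape_setTape_of_ne hk.symm]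
  rfl

theorem run_flush {k : Tape} {a l : List Bool} {s : State} (hk : k ≠ .aux)
    (ha : s.tape .aux = (a.map .digit).reverse) (hl : s.tape k = l.map .digit) :
    (flush k).run o s = setCarry false
      ((s.setTape k ((a ++ addCarry s.reg.carry l).map .digit)).setTape .aux []) := by
  rw [flush, run_seq, run_rippleAdd false hk hl, ha]
  simp only [Prog.run, setCarry, run_move hk.symm, addCarry]
  cases (ripple false s.reg.carry l).2 <;>
    simp [Prog.State.setTape, Prog.run, skip, emit, hk, Function.update_comm hk.symm]

theorem run_incr {k : Tape} {l : List Bool} {s : State} (hk : k ≠ .aux)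
    (ha : s.tape .aux = []) (hl : s.tape k = l.map .digit) :
    (incr k).run o s = setCarry false (s.setTape k ((addCarry true l).map .digit)) := by
  have hflush := run_flush (o := o) (s := setCarry true s) (a := []) hk ha hl
  have haux : (s.setTape k ((addCarry true l).map .digit)).tape .aux = [] := by
    rw [Prog.State.tape_setTape_of_ne hk.symm, ha]
  rw [incr, run_seq]
  refine hflush.trans ?_
  conv_rhs => rw [← Prog.State.setTape_self haux]
  rfl

theorem run_decr {k : Tape} {l : List Bool} {s : State} (hk : k ≠ .aux)
    (ha : s.tape .aux = []) (hl : s.tape k = l.map .digit) :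
    (decr k).run o s = setCarry (ripple true false l).2
      (s.setTape k ((ripple true false l).1.map .digit)) := by
  have hripple := run_rippleAdd (o := o) (s := setCarry false s) true hk hl
  have haux : (s.setTape k ((ripple true false l).1.map .digit)).tape .aux = [] := by
    rw [Prog.State.tape_setTape_of_ne hk.symm, ha]
  rw [decr, run_seq, run_seq]
  refine (congrArg _ hripple).trans ?_
  rw [run_move hk.symm, ← Prog.State.setTape_self haux]
  simp [setCarry, Prog.State.setTape, hk, ha, Function.update_comm hk.symm]

end Basic

/-! ### Running the reader -/

/-- The contents of the tapes. -/
structure Mem where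
  input : List Sym := []
  eqns : List Sym := []
  out : List Sym := []
  pivot : List Sym := []
  spare : List Sym := []
  index : List Sym := []
  param : List Sym := []
  pos : List Sym := []
  neg : List Sym := []
  aux : List Sym := []

namespace Mem

/-- The contents of a tape. -/
def get (m : Mem) : Tape → List Sym
  | .input => m.input
  | .eqns => m.eqns
  | .out => m.out
  | .pivot => m.pivot
  | .spare => m.spare
  | .index => m.index
  | .param => m.param
  | .pos => m.pos
  | .neg => m.neg
  | .aux => m.aux

/-- The contents of the tapes after the contents of one of them have been replaced. -/
def set (m : Mem) : Tape → List Sym → Mem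
  | .input, l => { m with input := l }
  | .eqns, l => { m with eqns := l }
  | .out, l => { m with out := l }
  | .pivot, l => { m with pivot := l }
  | .spare, l => { m with spare := l }
  | .index, l => { m with index := l }
  | .param, l => { m with param := l }
  | .pos, l => { m with pos := l }
  | .neg, l => { m with neg := l }
  | .aux, l => { m with aux := l }

/-- The state given by the contents of the tapes, the internal memory and the number of guesses. -/
def state (m : Mem) (r : Reg) (i : ℕ) : State := ⟨r, m.get, i⟩

variable (m : Mem) (r : Reg) (i : ℕ)

@[simp] theorem setTape_state (k : Tape) (l : List Sym) :
    (m.state r i).setTape k l = (m.set k l).state r i := by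
  simp only [state, Prog.State.setTape, Prog.State.mk.injEq, true_and, and_true]
  funext k'
  cases k <;> cases k' <;> simp [get, set]

@[simp] theorem tape_state : (m.state r i).tape = m.get := rfl

@[simp] theorem reg_state : (m.state r i).reg = r := rfl

@[simp] theorem pos_state : (m.state r i).pos = i := rfl

@[simp] theorem mk_get : Prog.State.mk r m.get i = m.state r i := rfl

@[simp] theorem setCarry_state (c : Bool) :
    setCarry c (m.state r i) = m.state { r with carry := c } i := rfl

end Mem

theorem initial_eq (word : List Sym) :
    Prog.State.initial {} .input word = Mem.state { input := word } {} 0 := by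
  rw [Prog.State.initial, show (⟨{}, fun _ => [], 0⟩ : State) = Mem.state {} {} 0 from ?_]
  · exact Mem.setTape_state _ _ _ _ _
  · simp only [Mem.state, Prog.State.mk.injEq, true_and, and_true]
    funext k
    cases k <;> rfl

/-- The word that represents an equation on the tape `eqns`. -/
def word (e : Equation) : List Sym :=
  e.row.map Sym.coef ++ Sym.rhs e.rhs :: (e.wt.bits.map Sym.digit ++ [Sym.sep])

/-- The tapes after `m` letters of the input word and `k` ticks have been counted. -/
def readMem (m k : ℕ) : Mem where
  index := m.bits.map .digit
  param := .replicate k .tick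
  neg := k.bits.map .digit

/-- The state agrees with a state of the parser after `m` letters of the input word and `k` ticks
have been read. -/
inductive Represents (m k : ℕ) : Parse → State → Prop
  | header (n : ℕ) : Represents m k (.header n)
      (Mem.state { readMem m k with pivot := .replicate n .tick } {} 0)
  | row {n : ℕ} (l : List Equation) {r : List Bool} (h : r.length ≤ n) :
      Represents m k (.row n l r) (Mem.state
        { readMem m k with
          pivot := .replicate (n - r.length) .tick
          spare := .replicate r.length .tick
          out := (l.flatMap word ++ r.map Sym.coef).reverse }
        { phase := .row, nz := decide (true ∈ r) } 0)
  | weight (l : List Equation) (r : List Bool) (b : Bool) (w : List Bool) :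
      Represents m k (.weight r.length l r b w) (Mem.state
        { readMem m k with
          pivot := .replicate r.length .tick
          out := (l.flatMap word ++ r.map Sym.coef ++ Sym.rhs b :: w.map Sym.digit).reverse }
        { phase := .weight, top := decide (w.getLast? = some true) } 0)
  | bad (pivot spare out : List Sym) :
      Represents m k .bad (Mem.state { readMem m k with pivot, spare, out } { phase := .bad } 0)

variable {o : ℕ → Bool} {m k : ℕ} {p : Parse} {s : State}

theorem Represents.bit (h : Represents m k p s) (b : Bool) :
    Represents m k (p.bit b) ((readBit b).run o s) := by
  cases h with
  | header n =>
    cases b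
    · exact .bad _ _ _
    · rw [Parse.bit, if_pos rfl]
      convert Represents.header _ using 1
      simp [readBit, byPhase, Prog.run, emit, Mem.get, Mem.set, List.replicate_succ]
  | @row n l r h =>
    rw [Parse.bit]
    split_ifs with hlt hmem
    · obtain ⟨d, rfl⟩ := Nat.exists_eq_add_of_lt hlt
      convert Represents.row l (r := r ++ [b]) (n := r.length + d + 1) (by simp)
        using 1
      simp [readBit, byPhase, Prog.run, emit, Mem.get, Mem.set,
        Nat.add_sub_add_left, add_assoc, List.replicate_succ]
    · obtain rfl : r.length = n := by omega
      convert Represents.weight l r b [] using 1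
      simp [readBit, byPhase, Prog.run, emit, enter, run_move, Mem.get, Mem.set, readMem, hmem]
    · obtain rfl : r.length = n := by omega
      convert Represents.bad _ _ _ using 1
      · simp [readBit, byPhase, Prog.run, enter, Mem.get, Mem.set, hmem]
        rfl
  | weight l r c w =>
    rw [Parse.bit]
    convert Represents.weight l r c (w ++ [b]) using 1
    simp [readBit, byPhase, Prog.run, emit, Mem.get, Mem.set]
  | bad _ _ _ => exact .bad _ _ _

theorem Represents.sep (h : Represents m k p s) : Represents m k p.sep (readSep.run o s) := by
  cases h with
  | header n => exact .row [] (Nat.zero_le n)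
  | row l h => exact .bad _ _ _
  | weight l r b w =>
    rw [Parse.sep]
    split_ifs with hw
    · convert Represents.row (l ++ [⟨r, b, ofBits w⟩]) (r := [])
        (Nat.zero_le r.length) using 1
      simp [readSep, byPhase, Prog.run, emit, enter, Mem.get, Mem.set, readMem, hw, word,
        bits_ofBits]
    · convert Represents.bad _ _ _ using 1
      · simp [readSep, byPhase, Prog.run, enter, hw]
        rfl
  | bad _ _ _ => exact .bad _ _ _

theorem Represents.incr_index (h : Represents m k p s) :
    Represents (m + 1) k p ((incr .index).run o s) := by
  have haux : s.tape .aux = [] := by cases h <;> rfl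
  have hindex : s.tape .index = m.bits.map .digit := by cases h <;> rfl
  rw [run_incr (by decide) haux hindex, addCarry_bits]
  cases h <;> simp only [Mem.setTape_state, Mem.setCarry_state]
  · exact .header _
  · exact .row _ ‹_›
  · exact .weight _ _ _ _
  · exact .bad _ _ _

theorem Represents.tick (h : Represents m k p s) :
    Represents m (k + 1) p ((readLetter .tick).run o s) := by
  have haux (x : List Sym) : (s.setTape .param x).tape .aux = [] := by cases h <;> rfl
  have hneg (x : List Sym) : (s.setTape .param x).tape .neg = k.bits.map .digit := by
    cases h <;> rfl
  have hparam : s.tape .param = .replicate k .tick := by cases h <;> rfl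
  rw [readLetter, run_seq, emit, Prog.run, hparam, run_incr (by decide) (haux _) (hneg _),
    addCarry_bits]
  cases h <;> simp only [Mem.setTape_state, Mem.setCarry_state]
  · exact .header _
  · exact .row _ ‹_›
  · exact .weight _ _ _ _
  · exact .bad _ _ _

/-- The letter of the program that presents a letter of the input word. -/
def letter : Option SysLetter → Sym
  | none => .tick
  | some .zero => .digit false
  | some .one => .digit true
  | some .sep => .sep

theorem letter_injective : Function.Injective letter := by
  rintro (_ | _ | _ | _) (_ | _ | _ | _) <;> simp [letter]

theorem represents_feed (x : List SysLetter) (k : ℕ) :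
    Represents x.length k (Parse.parse x)
      (feed o readLetter ((paramInput x k).map letter) (Mem.state {} {} 0)) := by
  induction k with
  | zero =>
    induction x using List.reverseRecOn with
    | nil => exact .header 0
    | append_singleton x a ih =>
      have hincr := ih.incr_index (o := o)
      rw [Parse.parse, List.foldl_concat, List.length_append, List.length_singleton]
      simp only [paramInput, List.replicate_zero, List.append_nil, List.map_append,
        feed_append] at ⊢ hincr
      cases a
      · exact hincr.bit false
      · exact hincr.bit true
      · exact hincr.sep
  | succ k ih =>
    rw [paramInput, List.replicate_succ', ← List.append_assoc, List.map_append, feed_append]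
    exact ih.tick

/-- The state after a system has been read, with the given digits on the tape `index`. -/
def systemState (l : List Equation) (index : List Bool) (k : ℕ) : State :=
  Mem.state
    { eqns := l.flatMap word
      index := index.map .digit
      param := .replicate k .tick
      neg := k.bits.map .digit }
    { phase := .row } 0

theorem Represents.run_finish_of_row {n : ℕ} {l : List Equation}
    (h : Represents m k (.row n l []) s) : finish.run o s = systemState l m.bits.tail k := by
  cases h
  simp [finish, Prog.run, run_skip, run_clear, run_move, Mem.get, Mem.set, readMem, systemState]

theorem Represents.reg_run_finish_of_ne_row (h : Represents m k p s)
    (hp : ∀ n l, p ≠ .row n l []) :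
    ((finish.run o s).reg.phase ≠ .row ∧ (finish.run o s).reg.ge = false) ∧
      (finish.run o s).pos = 0 := by
  cases h with
  | @row n l r h =>
    obtain ⟨b, r, rfl⟩ := List.exists_cons_of_ne_nil fun hr => hp n l (hr ▸ rfl)
    simp [finish, Prog.run, run_skip, enter, run_clear, run_move, Mem.get, Mem.set,
      List.replicate_succ]
  | bad pivot spare out =>
    cases spare <;>
    simp [finish, Prog.run, run_skip, enter, run_clear, run_move, Mem.get, Mem.set, readMem]
  | _ => simp [finish, Prog.run, run_skip, run_clear, run_move, Mem.get, Mem.set, readMem]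

end MaxLinAA

namespace MaxLinAA

open Equation (pivBit addRow pivBit_nil)

variable {o : ℕ → Bool} {m : Mem} {r : Reg} {i : ℕ}

/-! ### Running a round of elimination -/

theorem run_guess (haux : m.aux = []) : guess.run o (m.state r i) =
    Mem.state { m with index := (List.range m.index.length).map fun t => .digit (o (i + t)) } r
      (i + m.index.length) := by
  have hfeed (l : List Sym) (m : Mem) (i : ℕ) :
      feed o (fun _ => .flip fun b => emit .aux (.digit b)) l (m.state r i) = Mem.state { m with
        aux := ((List.range l.length).map fun t => .digit (o (i + t))).reverse ++ m.aux } r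
          (i + l.length) := by
    induction l generalizing m i with
    | nil => simp
    | cons a l ih =>
      have hflip : Prog.run o (.flip fun b => emit .aux (.digit b)) (m.state r i) =
          (m.set .aux (.digit (o i) :: m.aux)).state r (i + 1) := Mem.setTape_state _ _ _ _ _
      rw [feed_cons, hflip, ih]
      simp [List.range_succ_eq_map, Mem.set, Function.comp_def, add_assoc, add_comm 1]
  rw [guess, run_seq, run_forEach, Mem.setTape_state, hfeed, run_move (by decide)]
  simp [Mem.get, Mem.set, haux]

theorem feed_extractLetter_digit (w : List Bool) :
    feed o extractLetter (w.map .digit) (m.state r i) =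
      Mem.state { m with out := (w.map .digit).reverse ++ m.out } r i := by
  induction w generalizing m with
  | nil => rfl
  | cons b w ih => simp [extractLetter, Prog.run, emit, ih, Mem.get, Mem.set]

theorem feed_extractLetter_word (hcopying : r.copying = false) (e : Equation) :
    feed o extractLetter (word e) (m.state r i) =
      advance.run o (Mem.state { m with out := (word e).reverse ++ m.out } r i) := by
  have hcoef (row : List Bool) (m : Mem) : feed o extractLetter (row.map .coef) (m.state r i) =
      Mem.state { m with out := (row.map .coef).reverse ++ m.out } r i := by
    induction row generalizing m with
    | nil => rfl
    | cons b row ih => simp [extractLetter, Prog.run, hcopying, emit, ih, Mem.get, Mem.set]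
  simp only [word, feed_append, feed_cons, hcoef]
  simp [extractLetter, Prog.run, hcopying, emit, feed_extractLetter_digit, Mem.get, Mem.set]

theorem feed_extractLetter_word_of_copying (hcopying : r.copying = true) (hnz : r.nz = false)
    (e : Equation) : feed o extractLetter (word e) (m.state r i) = advance.run o (Mem.state { m with
        spare := (e.row.map .coef).reverse ++ m.spare
        out := (word e.reduced).reverse ++ m.out }
      { r with nz := decide (true ∈ e.row), rhs := e.rhs } i) := by
  have hcoef (row : List Bool) (m : Mem) (r : Reg) (hcopying : r.copying = true) :
      feed o extractLetter (row.map .coef) (m.state r i) =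
      Mem.state { m with spare := (row.map .coef).reverse ++ m.spare }
        { r with nz := r.nz || decide (true ∈ row) } i := by
    induction row generalizing m r with
    | nil => simp
    | cons b row ih =>
      simp [extractLetter, Prog.run, hcopying, emit, ih, Mem.get, Mem.set]
      cases r.nz <;> cases b <;> simp
  simp only [word, feed_append, feed_cons, hcoef _ _ _ hcopying, Equation.reduced]
  simp [extractLetter, Prog.run, hcopying, hnz, emit, feed_extractLetter_digit, Mem.get, Mem.set]

theorem feed_extractLetter_of_found (hcopying : r.copying = false) (hfound : r.found = true)
    (l : List Equation) : feed o extractLetter (l.flatMap word) (m.state r i) =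
      Mem.state { m with out := (l.flatMap word).reverse ++ m.out } r i := by
  have hadvance (m : Mem) : advance.run o (m.state r i) = m.state r i := by
    cases r
    simp_all [advance, Prog.run]
  induction l generalizing m with
  | nil => rfl
  | cons e l ih => simp [feed_append, feed_extractLetter_word hcopying, hadvance, ih]

theorem run_advance {index : List Bool} {c : Bool} (hindex : m.index = index.map .digit)
    (haux : m.aux = []) : advance.run o (m.state { phase := .row, carry := c } i) =
      Mem.state { m with index := (ripple true false index).1.map .digit }
        { phase := .row
          carry := ofBits index ≠ 0
          copying := ofBits index = 0
          found := ofBits index = 0 } i := by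
  have hdecr := run_decr (o := o) (k := .index) (s := m.state { phase := .row, carry := c } i)
    (by decide) haux hindex
  simp [advance, Prog.run, hdecr, ripple_true_snd, Mem.set]

theorem feed_extractLetter (l : List Equation) {index : List Bool} {c : Bool}
    (hindex : m.index = index.map .digit) (haux : m.aux = []) (hspare : m.spare = []) :
    ∃ (index' : List Bool) (r' : Reg), index'.length = index.length ∧ r'.phase = .row ∧
      r'.piv = none ∧ r'.rhs = (l.getD (ofBits index) ⟨[], false, 0⟩).rhs ∧
      feed o extractLetter (l.flatMap word)
        (advance.run o (m.state { phase := .row, carry := c } i)) = Mem.state { m with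
          index := index'.map .digit
          spare := ((l.getD (ofBits index) ⟨[], false, 0⟩).row.map .coef).reverse
          out := ((l.modify (ofBits index) Equation.reduced).flatMap word).reverse ++ m.out }
        r' i := by
  induction l generalizing m index c with
  | nil =>
    rw [run_advance hindex haux]
    refine ⟨_, { phase := .row
                 carry := ofBits index ≠ 0
                 copying := ofBits index = 0
                 found := ofBits index = 0 }, length_ripple true false index, rfl, rfl, rfl, ?_⟩
    simp [hspare]
  | cons e l ih =>
    rw [run_advance hindex haux, List.flatMap_cons, feed_append]
    by_cases h0 : ofBits index = 0
    · refine ⟨_, { phase := .row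
                   nz := decide (true ∈ e.row)
                   rhs := e.rhs
                   found := true }, length_ripple true false index, rfl, rfl, by simp [h0], ?_⟩
      simp only [h0, not_true_eq_false, ne_eq, decide_true, decide_false]
      rw [feed_extractLetter_word_of_copying rfl rfl]
      simp only [advance, Prog.run, Mem.reg_state]
      exact (feed_extractLetter_of_found rfl rfl l).trans (by simp [hspare])
    · obtain ⟨index', r', hlength, hphase, hpiv, hrhs, hfeed⟩ := ih (m := { m with
          index := (ripple true false index).1.map .digit
          out := (word e).reverse ++ m.out }) (c := true) rfl haux hspare
      refine ⟨index', r', hlength.trans (length_ripple true false index), hphase, hpiv, ?_, ?_⟩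
      · obtain ⟨v, hv⟩ := Nat.exists_eq_succ_of_ne_zero h0
        simpa [ofBits_ripple_true h0, hv] using hrhs
      · simp only [ne_eq, h0, not_false_eq_true, decide_true, decide_false, feed_extractLetter_word,
          List.getD_eq_getElem?_getD]
        rw [hfeed]
        obtain ⟨v, hv⟩ := Nat.exists_eq_succ_of_ne_zero h0
        simp [ofBits_ripple_true h0, hv]

theorem run_extract {l : List Equation} {index : List Bool} (heqns : m.eqns = l.flatMap word)
    (hindex : m.index = index.map .digit) (haux : m.aux = []) (hspare : m.spare = [])
    (hout : m.out = []) (hpivot : m.pivot = []) :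
    ∃ (index' : List Bool) (r : Reg), index'.length = index.length ∧ r.phase = .row ∧
      r.piv = none ∧ r.rhs = (l.getD (ofBits index) ⟨[], false, 0⟩).rhs ∧
      extract.run o (m.state { phase := .row } i) = Mem.state { m with
        eqns := (l.modify (ofBits index) Equation.reduced).flatMap word
        index := index'.map .digit
        pivot := (l.getD (ofBits index) ⟨[], false, 0⟩).row.map .coef } r i := by
  obtain ⟨index', r, hlength, hphase, hpiv, hrhs, hfeed⟩ := feed_extractLetter (o := o) (i := i)
    (m := { m with eqns := [] }) (c := false) l hindex haux hspare
  refine ⟨index', r, hlength, hphase, hpiv, hrhs, ?_⟩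
  rw [run_advance (m := { m with eqns := [] }) hindex haux] at hfeed
  rw [extract, run_seq, run_advance hindex haux, run_seq, run_forEach, Mem.setTape_state]
  rw [← heqns] at hfeed
  refine (congrArg _ hfeed).trans ?_
  simp [run_seq, run_move, Mem.get, Mem.set, hout, hpivot, hspare]

theorem feed_elimLetter_coef {R : List Bool} (hpivot : m.pivot = R.map .coef) (row : List Bool) :
    ∃ q, (q == some true) = r.piv.getD (pivBit R row) ∧
      feed o elimLetter (row.map .coef) (m.state r i) = Mem.state { m with
          pivot := (R.drop row.length).map .coef
          spare := ((R.take row.length).map .coef).reverse ++ m.spare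
          out := ((if r.piv.getD (pivBit R row) then addRow row R else row).map .coef).reverse ++
            m.out }
        { r with piv := q } i := by
  induction row generalizing m r R with
  | nil =>
    refine ⟨r.piv, ?_, by simp [addRow, ← hpivot]⟩
    rw [pivBit_nil]
    rcases r.piv with _ | _ | _ <;> rfl
  | cons b row ih =>
    obtain _ | ⟨a, R⟩ := R
    · obtain ⟨q, hq, hfeed⟩ := ih (m := { m with out := Sym.coef b :: m.out }) (r := r) hpivot
      have hstep : (elimLetter (.coef b)).run o (m.state r i) =
          Mem.state { m with out := .coef b :: m.out } r i := by
        simp [elimLetter, Prog.run, hpivot, emit, Mem.get, Mem.set]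
      have haddRow : addRow row [] = row := by cases row <;> rfl
      refine ⟨q, hq, ?_⟩
      rw [List.map_cons, feed_cons, hstep]
      exact hfeed.trans (by simp [haddRow, addRow])
    · obtain ⟨q, hq, hfeed⟩ := ih (R := R)
        (m := { m with
          pivot := R.map .coef
          spare := Sym.coef a :: m.spare
          out := .coef (b ^^ (a && r.piv.or (bif a then some b else none) == some true)) :: m.out })
        (r := { r with piv := r.piv.or (bif a then some b else none) }) rfl
      have hsum : (if r.piv.getD (pivBit (a :: R) (b :: row)) then addRow (b :: row) (a :: R)
            else b :: row) =
          (b ^^ (a && r.piv.or (bif a then some b else none) == some true)) ::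
            if (r.piv.or (bif a then some b else none)).getD (pivBit R row) then addRow row R
            else row := by
        rcases r.piv with _ | _ | _ <;> cases a <;> cases b <;> cases hpiv : pivBit R row <;>
          simp [pivBit, addRow, hpiv]
      refine ⟨q, ?_, ?_⟩
      · rw [hq]
        rcases r.piv with _ | _ <;> cases a <;> simp [pivBit]
      · rw [hsum]
        simp [elimLetter, Prog.run, hpivot, emit, Mem.get, Mem.set, Sym.bit, hfeed]

theorem feed_elimLetter_word {p : Equation} (hpivot : m.pivot = p.row.map .coef)
    (hspare : m.spare = []) (hpiv : r.piv = none) (hrhs : r.rhs = p.rhs) (e : Equation) :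
    feed o elimLetter (word e) (m.state r i) =
      Mem.state { m with out := (word (p.elim e)).reverse ++ m.out } r i := by
  have hdigit (w : List Bool) (m : Mem) (r : Reg) : feed o elimLetter (w.map .digit) (m.state r i) =
      Mem.state { m with out := (w.map .digit).reverse ++ m.out } r i := by
    induction w generalizing m with
    | nil => rfl
    | cons b w ih => simp [elimLetter, Prog.run, emit, ih, Mem.get, Mem.set]
  obtain ⟨q, hq, hcoef⟩ := feed_elimLetter_coef (o := o) (r := r) (i := i) hpivot e.row
  rw [hpiv, Option.getD_none] at hq hcoef
  rw [word, feed_append, feed_cons, hcoef, feed_append]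
  have hr : { r with rhs := p.rhs, piv := none } = r := by cases r; simp_all
  cases hbit : pivBit p.row e.row <;>
    simp [elimLetter, Prog.run, run_move, hdigit, emit, Mem.get, Mem.set, hq, hbit, hr, hspare,
      hpivot, hrhs, word, Equation.elim]

theorem feed_elimLetter {p : Equation} (hpivot : m.pivot = p.row.map .coef)
    (hspare : m.spare = []) (hpiv : r.piv = none) (hrhs : r.rhs = p.rhs) (l : List Equation) :
    feed o elimLetter (l.flatMap word) (m.state r i) =
      Mem.state { m with out := ((l.map p.elim).flatMap word).reverse ++ m.out } r i := by
  induction l generalizing m with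
  | nil => rfl
  | cons e l ih =>
    rw [List.flatMap_cons, feed_append, feed_elimLetter_word hpivot hspare hpiv hrhs]
    refine (ih (m := { m with out := (word (p.elim e)).reverse ++ m.out }) hpivot hspare).trans ?_
    simp

theorem run_eliminate {p : Equation} {l : List Equation} (heqns : m.eqns = l.flatMap word)
    (hpivot : m.pivot = p.row.map .coef) (hspare : m.spare = []) (hout : m.out = [])
    (hphase : r.phase = .row) (hpiv : r.piv = none) (hrhs : r.rhs = p.rhs) :
    eliminate.run o (m.state r i) =
      Mem.state { m with eqns := (l.map p.elim).flatMap word, pivot := [] }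
        { phase := .row } i := by
  have hfeed := feed_elimLetter (o := o) (m := { m with eqns := [] }) (i := i) hpivot
    hspare hpiv hrhs l
  rw [eliminate, run_seq, run_forEach, Mem.setTape_state, Mem.tape_state, Mem.get, heqns]
  refine (congrArg _ hfeed).trans ?_
  simp [Prog.run, run_clear, run_move, Mem.get, Mem.set, hout, hphase]

end MaxLinAA

namespace MaxLinAA

open Equation (elimAt)

variable {o : ℕ → Bool}

/-! ### Running all rounds of elimination -/

theorem elimAt_eq (l : List Equation) (j : ℕ) :
    elimAt l j = (l.modify j Equation.reduced).map (l.getD j ⟨[], false, 0⟩).elim := by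
  rw [elimAt, List.getD_eq_getElem?_getD]
  cases h : l[j]? with
  | none =>
    have hid : (⟨[], false, 0⟩ : Equation).elim = id := funext fun e => rfl
    rw [Option.getD_none, hid, List.map_id,
      List.modify_eq_self (List.getElem?_eq_none_iff.mp h)]
  | some e => rw [List.modify_eq_set_getElem?, h]; rfl

theorem run_round (l : List Equation) (index : List Bool) (neg : List Sym) (i : ℕ) :
    ∃ index' : List Bool, index'.length = index.length ∧
      (guess ;; extract ;; eliminate).run o
        (Mem.state { eqns := l.flatMap word, index := index.map .digit, neg } { phase := .row } i) =
      Mem.state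
        { eqns :=
            (elimAt l (ofBits ((List.range index.length).map fun t => o (i + t)))).flatMap word
          index := index'.map .digit
          neg } { phase := .row } (i + index.length) := by
  obtain ⟨index', r, hlength, hphase, hpiv, hrhs, hextract⟩ := run_extract (o := o)
    (m := { eqns := l.flatMap word
            index := ((List.range index.length).map fun t => o (i + t)).map .digit
            neg }) (i := i + index.length) rfl rfl rfl rfl rfl rfl
  refine ⟨index', by simpa using hlength, ?_⟩
  rw [run_seq, run_seq, run_guess rfl]
  simp only [List.length_map, List.map_map, Function.comp_def] at hextract ⊢
  rw [hextract, run_eliminate rfl rfl rfl rfl hphase hpiv hrhs, elimAt_eq]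

/-- The numbers that `k` guesses of `m` bits each spell out, starting at the guess `i`. -/
def guesses (o : ℕ → Bool) (m k i : ℕ) : List ℕ :=
  (List.range k).map fun r => ofBits ((List.range m).map fun t => o (i + r * m + t))

theorem run_rounds (l : List Equation) (index : List Bool) (k : ℕ) :
    ∃ index' : List Bool, rounds.run o (systemState l index k) =
      Mem.state
        { eqns := ((guesses o index.length k 0).foldl elimAt l).flatMap word
          index := index'.map .digit
          neg := k.bits.map .digit } { phase := .row } (k * index.length) := by
  have hfeed (k i : ℕ) (l : List Equation) (index : List Bool) (neg : List Sym) :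
      ∃ index' : List Bool,
        feed o (fun _ => guess ;; extract ;; eliminate) (.replicate k .tick)
          (Mem.state { eqns := l.flatMap word, index := index.map .digit, neg }
            { phase := .row } i) =
        Mem.state
          { eqns := ((guesses o index.length k i).foldl elimAt l).flatMap word
            index := index'.map .digit
            neg } { phase := .row } (i + k * index.length) := by
    induction k generalizing i l index with
    | zero => exact ⟨index, by simp [guesses]⟩
    | succ k ih =>
      obtain ⟨index₁, hlength, hround⟩ := run_round (o := o) l index neg i
      rw [List.replicate_succ, feed_cons, hround]
      obtain ⟨index₂, hrest⟩ := ih (i + index.length)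
        (elimAt l (ofBits ((List.range index.length).map fun t => o (i + t)))) index₁
      refine ⟨index₂, ?_⟩
      rw [hrest, hlength]
      simp [guesses, List.range_succ_eq_map, Function.comp_def, Nat.succ_mul, add_assoc, add_comm,
        add_left_comm]
  obtain ⟨index', h⟩ := hfeed k 0 l index (k.bits.map .digit)
  refine ⟨index', ?_⟩
  rw [rounds, run_forEach, systemState, Mem.setTape_state]
  exact h.trans (by rw [zero_add])

theorem exists_guesses_eq {m : ℕ} {js : List ℕ} (hjs : ∀ j ∈ js, j < 2 ^ m) :
    ∃ o, guesses o m js.length 0 = js := by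
  refine ⟨fun i => (js.getD (i / m) 0).testBit (i % m), ?_⟩
  refine List.ext_getElem (by simp [guesses]) fun r hr hr' => ?_
  have hbits : (List.range m).map (fun t =>
      (js.getD ((0 + r * m + t) / m) 0).testBit ((0 + r * m + t) % m)) =
      (List.range m).map js[r].testBit := by
    refine List.map_congr_left fun t ht => ?_
    have htm : t < m := List.mem_range.mp ht
    have hm : 0 < m := t.zero_le.trans_lt htm
    have hrow : 0 + r * m + t = t + m * r := by ring
    rw [hrow, Nat.add_mul_div_left _ _ hm, Nat.add_mul_mod_self_left, Nat.div_eq_of_lt htm,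
      Nat.mod_eq_of_lt htm, zero_add, List.getD_eq_getElem _ _ hr']
  simp only [guesses, List.getElem_map, List.getElem_range]
  rw [hbits, ofBits_eq_of_testBit (hjs _ (List.getElem_mem hr'))]

end MaxLinAA

namespace MaxLinAA

open Equation (score)

variable {o : ℕ → Bool}

/-! ### Evaluating the score -/

theorem feed_evalLetter_weight {k : Tape} {a l : List Bool} {s : State} (w : List Bool)
    (hnz : s.reg.nz = false) (hk : (bif s.reg.rhs then .neg else .pos) = k)
    (haux : s.tape .aux = (a.map .digit).reverse) (hl : s.tape k = l.map .digit) :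
    feed o evalLetter (w.map .digit ++ [.sep]) s =
      { (s.setTape k ((a ++ addBits s.reg.carry l w).map .digit)).setTape .aux [] with
        reg := { phase := s.reg.phase } } := by
  have hne : k ≠ .aux := by cases hrhs : s.reg.rhs <;> simp [← hk, hrhs]
  induction w generalizing a l s with
  | nil =>
    have hflush := run_flush (o := o) hne haux hl
    cases hrhs : s.reg.rhs <;> rw [hrhs, cond] at hk <;> subst hk <;>
      simp [evalLetter, Prog.run, hnz, hrhs, hflush, addBits, setCarry] <;> rfl
  | cons b w ih =>
    have hstep : (evalLetter (.digit b)).run o s = (addDigit k b).run o s := by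
      cases hrhs : s.reg.rhs <;> simp [evalLetter, Prog.run, hnz, hrhs, ← hk]
    have hadd : (addDigit k b).run o s = setCarry ((l.headD false).atLeastTwo b s.reg.carry)
        ((s.setTape k (l.tail.map .digit)).setTape .aux
          (.digit (l.headD false ^^ b ^^ s.reg.carry) :: s.tape .aux)) := by
      cases l <;>
        simp [addDigit, Prog.run, hl, run_fullAdd, Prog.State.setTape, hne.symm, Sym.bit]
    rw [List.map_cons, List.cons_append, feed_cons, hstep, hadd,
      ih (a := a ++ [l.headD false ^^ b ^^ s.reg.carry]) (l := l.tail)]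
    all_goals simp [setCarry, Prog.State.setTape, Function.update_comm hne.symm, hne, haux, hnz, hk,
      addBits]

theorem feed_evalLetter_coef (r : List Bool) (m : Mem) (reg : Reg) (i : ℕ) :
    feed o evalLetter (r.map .coef) (m.state reg i) =
      m.state { reg with nz := reg.nz || decide (true ∈ r) } i := by
  induction r generalizing reg with
  | nil => simp
  | cons b r ih =>
    refine (ih { reg with nz := reg.nz || b }).trans ?_
    cases b <;> simp

theorem feed_evalLetter_weight_of_nz (w : List Bool) (m : Mem) {r : Reg} (h : r.nz = true) (i : ℕ) :
    feed o evalLetter (w.map .digit ++ [.sep]) (m.state r i) = m.state { phase := r.phase } i := by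
  have hskip (b : Bool) : (evalLetter (.digit b)).run o (m.state r i) = m.state r i := by
    simp [evalLetter, Prog.run, run_skip, h]
  induction w with
  | nil => simp [evalLetter, Prog.run, run_skip, h]
  | cons b w ih => rw [List.map_cons, List.cons_append, feed_cons, hskip, ih]

theorem feed_evalLetter_word (e : Equation) (index : List Sym) (pos neg : List Bool) (i : ℕ) :
    ∃ pos' neg' : List Bool,
      (ofBits pos' : ℤ) - ofBits neg' = ofBits pos - ofBits neg + e.const ∧
      feed o evalLetter (word e)
          (Mem.state { index, pos := pos.map .digit, neg := neg.map .digit } { phase := .row } i) =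
        Mem.state { index, pos := pos'.map .digit, neg := neg'.map .digit }
          { phase := .row } i := by
  have hrow (m : Mem) : feed o evalLetter (word e) (m.state { phase := .row } i) =
      feed o evalLetter (e.wt.bits.map .digit ++ [.sep])
        (m.state { phase := .row, nz := decide (true ∈ e.row), rhs := e.rhs } i) := by
    rw [word, feed_append, feed_evalLetter_coef]
    simp [evalLetter, Prog.run]
  simp only [hrow, Equation.const]
  split_ifs with hnz hrhs
  · exact ⟨pos, neg, by simp, feed_evalLetter_weight_of_nz _ _ (by simpa using hnz) i⟩
  · refine ⟨pos, addBits false neg e.wt.bits, by simp [ofBits_addBits, ofBits_bits]; ring, ?_⟩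
    rw [feed_evalLetter_weight (k := .neg) (a := []) (l := neg) _ (by simpa using hnz)
      (by simp [hrhs]) rfl rfl]
    simp [Mem.set]
  · refine ⟨addBits false pos e.wt.bits, neg, by simp [ofBits_addBits, ofBits_bits]; ring, ?_⟩
    rw [feed_evalLetter_weight (k := .pos) (a := []) (l := pos) _ (by simpa using hnz)
      (by simp [hrhs]) rfl rfl]
    simp [Mem.set]

theorem run_evalLetter (l : List Equation) (index : List Sym) (neg : List Bool) (i : ℕ) :
    ∃ pos' neg' : List Bool, (ofBits pos' : ℤ) - ofBits neg' = score l - ofBits neg ∧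
      Prog.run o (.forEach .eqns evalLetter)
          (Mem.state { eqns := l.flatMap word, index, neg := neg.map .digit } { phase := .row } i) =
        Mem.state { index, pos := pos'.map .digit, neg := neg'.map .digit }
          { phase := .row } i := by
  have hfeed (pos neg : List Bool) : ∃ pos' neg' : List Bool,
      (ofBits pos' : ℤ) - ofBits neg' = ofBits pos - ofBits neg + score l ∧
      feed o evalLetter (l.flatMap word)
          (Mem.state { index, pos := pos.map .digit, neg := neg.map .digit } { phase := .row } i) =
        Mem.state { index, pos := pos'.map .digit, neg := neg'.map .digit }
          { phase := .row } i := by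
    induction l generalizing pos neg with
    | nil => exact ⟨pos, neg, by simp [score], rfl⟩
    | cons e l ih =>
      obtain ⟨pos₁, neg₁, hword, hfeed⟩ := feed_evalLetter_word (o := o) e index pos neg i
      obtain ⟨pos₂, neg₂, hrest, hfeed'⟩ := ih pos₁ neg₁
      refine ⟨pos₂, neg₂, ?_, by rw [List.flatMap_cons, feed_append, hfeed, hfeed']⟩
      rw [hrest, hword, score, score, List.map_cons, List.sum_cons, add_assoc]
  obtain ⟨pos', neg', hscore, h⟩ := hfeed [] neg
  refine ⟨pos', neg', by rw [hscore]; simp [ofBits]; ring, ?_⟩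
  rw [run_forEach, Mem.setTape_state]
  exact h

theorem feed_borrow (l : List Bool) (m : Mem) (r : Reg) (i : ℕ) :
    feed o (fun a => .load fun r => { r with ge := r.ge && !a.bit }) (l.map .digit)
      (m.state r i) = m.state { r with ge := r.ge && decide (true ∉ l) } i := by
  induction l generalizing r with
  | nil => simp
  | cons b l ih =>
    refine (ih { r with ge := r.ge && !b }).trans ?_
    cases b <;> simp

theorem run_compareDigit {m : Mem} {l : List Bool} (hneg : m.neg = l.map .digit) (b : Bool)
    (r : Reg) (i : ℕ) : (compareDigit b).run o (m.state r i) =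
      Mem.state { m with neg := l.tail.map .digit }
        { r with ge := if b = l.headD false then r.ge else b } i := by
  cases l <;> simp [compareDigit, Prog.run, Mem.get, Mem.set, hneg, Sym.bit]

theorem run_compare {pos neg : List Bool} {m : Mem} (hpos : m.pos = pos.map .digit)
    (hneg : m.neg = neg.map .digit) (r : Reg) (i : ℕ) :
    compare.run o (m.state r i) =
      Mem.state { m with pos := [], neg := [] } { r with ge := geBits true pos neg } i := by
  have hdigits (l neg : List Bool) (m : Mem) (r : Reg) (hneg : m.neg = neg.map .digit) :
      Prog.run o (.forEach .neg fun a => .load fun r => { r with ge := r.ge && !a.bit })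
        (feed o (fun a => compareDigit a.bit) (l.map .digit) (m.state r i)) =
      Mem.state { m with neg := [] } { r with ge := geBits r.ge l neg } i := by
    induction l generalizing neg m r with
    | nil =>
      rw [List.map_nil, feed_nil, run_forEach, Mem.tape_state, Mem.get, hneg, Mem.setTape_state,
        feed_borrow]
      rfl
    | cons b l ih =>
      rw [List.map_cons, feed_cons, Sym.bit, run_compareDigit hneg]
      exact ih neg.tail _ _ rfl
  have hcompare : compare.run o (m.state r i) =
      Prog.run o (.forEach .neg fun a => .load fun r => { r with ge := r.ge && !a.bit })
        (feed o (fun a => compareDigit a.bit) m.pos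
          ((m.state { r with ge := true } i).setTape .pos [])) := rfl
  rw [hcompare, Mem.setTape_state, hpos]
  exact hdigits pos neg _ _ hneg

end MaxLinAA

namespace MaxLinAA

open Equation

/-! ### Correctness -/

theorem length_tail_bits (n : ℕ) : n.bits.tail.length = Nat.log 2 n := by
  obtain rfl | hn := eq_or_ne n 0
  · simp
  rw [List.length_tail, Nat.size_eq_bits_len]
  refine (Nat.log_eq_of_pow_le_of_lt_pow (Nat.lt_size.1 ?_) ?_).symm
  · exact Nat.sub_one_lt (Nat.size_pos.2 hn.bot_lt).ne'
  · rw [Nat.sub_add_cancel (Nat.size_pos.2 hn.bot_lt)]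
    exact Nat.lt_size_self n

variable (o : ℕ → Bool) (x : List SysLetter) (k : ℕ)

/-- The final state of the program on the instance `(x, k)`. -/
def finalState : State := program.run o (.initial {} .input ((paramInput x k).map letter))

theorem finalState_eq : finalState o x k =
    Prog.run o (.ite (·.phase = .row) (rounds ;; .forEach .eqns evalLetter ;; compare) skip)
      (finish.run o (feed o readLetter ((paramInput x k).map letter) (Mem.state {} {} 0))) := by
  rw [finalState, initial_eq, program, run_seq, read, run_seq, run_forEach, Mem.setTape_state]
  rfl

variable {x}

theorem finalState_of_parse_eq_row {n : ℕ} {l : List Equation}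
    (hx : Parse.parse x = .row n l []) :
    (finalState o x k).pos = k * Nat.log 2 x.length ∧
      ((finalState o x k).reg.ge ↔
        k ≤ score ((guesses o (Nat.log 2 x.length) k 0).foldl elimAt l)) := by
  have hread := hx ▸ represents_feed (o := o) x k
  rw [finalState_eq, hread.run_finish_of_row]
  obtain ⟨index, hrounds⟩ := run_rounds (o := o) l x.length.bits.tail k
  obtain ⟨pos, neg, hscore, heval⟩ := run_evalLetter (o := o)
    ((guesses o x.length.bits.tail.length k 0).foldl elimAt l) (index.map .digit) k.bits
    (k * x.length.bits.tail.length)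
  have hite : Prog.run o
      (.ite (·.phase = .row) (rounds ;; .forEach .eqns evalLetter ;; compare) skip)
      (systemState l x.length.bits.tail k) =
      (rounds ;; .forEach .eqns evalLetter ;; compare).run o
        (systemState l x.length.bits.tail k) := rfl
  rw [hite, run_seq, run_seq, hrounds, heval, run_compare rfl rfl, Mem.pos_state, Mem.reg_state,
    geBits_iff, ← length_tail_bits]
  rw [ofBits_bits] at hscore
  refine ⟨rfl, ?_⟩
  simp only [Bool.toNat_true]
  omega

theorem finalState_of_parse_ne_row (hx : ∀ n l, Parse.parse x ≠ .row n l []) :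
    (finalState o x k).pos = 0 ∧ (finalState o x k).reg.ge = false := by
  obtain ⟨⟨hphase, hge⟩, hpos⟩ :=
    (represents_feed (o := o) x k).reg_run_finish_of_ne_row (o := o) hx
  rw [finalState_eq, Prog.run, decide_eq_false hphase]
  exact ⟨hpos, hge⟩

theorem pos_finalState_le : (finalState o x k).pos ≤ k * Nat.log 2 x.length := by
  by_cases hx : ∃ n l, Parse.parse x = .row n l []
  · obtain ⟨n, l, hx⟩ := hx
    exact (finalState_of_parse_eq_row o k hx).1.le
  · push Not at hx
    exact (finalState_of_parse_ne_row o k hx).1.trans_le (Nat.zero_le _)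

theorem mem_maxLinAA_iff_exists_guesses :
    (x, k) ∈ MaxLinAA ↔ ∃ o, (finalState o x k).reg.ge = true := by
  rw [mem_maxLinAA_iff]
  constructor
  · rintro ⟨n, l, hl, rfl, z, hz⟩
    obtain ⟨js, rfl, hjs, hscore⟩ := exists_le_score_foldl_elimAt (fun e he => (hl e he).fits)
      (score_eq_zero_of_valid hl).ge hz
    obtain ⟨o, ho⟩ := exists_guesses_eq fun j hj =>
      (hjs j hj).trans_lt (length_lt_two_pow_log_length_encode hl)
    refine ⟨o, (finalState_of_parse_eq_row o _ (Parse.parse_eq_row_iff.2 ⟨hl, rfl⟩)).2.2 ?_⟩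
    rwa [ho]
  · rintro ⟨o, ho⟩
    obtain ⟨n, l, hx⟩ : ∃ n l, Parse.parse x = .row n l [] := by
      by_contra! hx
      simp [(finalState_of_parse_ne_row o k hx).2] at ho
    obtain ⟨hl, hencode⟩ := Parse.parse_eq_row_iff.1 hx
    obtain ⟨z, hz⟩ := exists_score_foldl_elimAt_le (fun e he => (hl e he).fits)
      (guesses o (Nat.log 2 x.length) k 0)
    exact ⟨n, l, hl, hencode, z, ((finalState_of_parse_eq_row o k hx).2.1 ho).trans hz⟩

end MaxLinAA

theorem mainTheorem6 : InWP MaxLinAA :=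
  Prog.inWP MaxLinAA.wellFormed_program .input ⟨MaxLinAA.letter, MaxLinAA.letter_injective⟩ {}
    (·.ge) .id (fun _ k o => MaxLinAA.pos_finalState_le o k)
    (fun _ k => MaxLinAA.mem_maxLinAA_iff_exists_guesses k)
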